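/- Let $k$ be a field and let $\mathcal{F}$ be a Frobenius category, i.e. a Quillen exact category with enough projectives and enough injectives in which an object is projective if and only if it is injective (where $P$ is projective if $\mathrm{Ext}^1_{\mathcal F}(P,X)=0$ for all $X$, and dually for injective). Assume that $\mathcal{F}$ is essentially small, idempotent complete, $k$-linear, and Hom-finite, in the sense that $|\mathrm{Hom}_{\mathcal F}(A,B)|<\infty$ for all objects $A,B$. Let $\mathcal{P}(\mathcal{F})$ be the full subcategory of projective-injective objects, and let $\underline{\mathcal F}$ be the stable category: it has the objects of $\mathcal F$, and its morphisms are those of $\mathcal F$ modulo the morphisms that factor through an object of $\mathcal P(\mathcal F)$. The Hall algebra $\mathcal{H}(\mathcal{F})$ is the $\mathbb{Q}$-algebra with basis the isomorphism classes $[A]$ of objects of $\mathcal F$, unit $[0]$ and product $$[A]\diamond[C]=\sum_{[B]}\frac{|\mathrm{Ext}^1_{\mathcal F}(A,C)_B|}{|\mathrm{Hom}_{\mathcal F}(A,C)|}\,[B],$$ where $\mathrm{Ext}^1_{\mathcal F}(A,C)_B\subset \mathrm{Ext}^1_{\mathcal F}(A,C)$ is the set of classes of conflations $C\rightarrowtail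 B'\twoheadrightarrow A$ with $B'\cong B$. The semi-derived Hall algebra is the localization $\mathcal{SDH}(\mathcal F,\mathcal P(\mathcal F))=\mathcal H(\mathcal F)\big[[P]^{-1} : P\in\mathcal P(\mathcal F)\big]$. Let $\langle\cdot,\cdot\rangle:K_0(\mathcal P(\mathcal F))\times K_0(\mathcal P(\mathcal F))\to\mathbb{Q}^\times$ be the Euler form, i.e. the bilinear form with $\langle [P],[Q]\rangle=|\mathrm{Hom}_{\mathcal F}(P,Q)|$ for $P,Q\in\mathcal P(\mathcal F)$. The quantum torus $\mathbb{T}(\mathcal P(\mathcal F))$ is the group algebra of $K_0(\mathcal P(\mathcal F))$ over $\mathbb Q$ with the multiplication twisted by the Euler form: it has a $\mathbb Q$-basis $t_a$, $a\in K_0(\mathcal P(\mathcal F))$, with $t_a t_b=\langle a,b\rangle^{-1}t_{a+b}$. Then there is a unique homomorphism of unital $\mathbb Q$-algebras $\mathbb{T}(\mathcal P(\mathcal F))\to\mathcal{SDH}(\mathcal F,\mathcal P(\mathcal F))$ that sends $t_{[P]}$ to $[P]$ for every $P\in\mathcal P(\mathcal F)$. Let $\mathbb{T}(\mathcal P(\mathcal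 F))$ act on $\mathcal{SDH}(\mathcal F,\mathcal P(\mathcal F))$ by left (respectively right) multiplication through this homomorphism. With these actions, $\mathcal{SDH}(\mathcal F,\mathcal P(\mathcal F))$ is a free left and a free right module over $\mathbb{T}(\mathcal P(\mathcal F))$. Moreover, for any choice of representatives $M_\alpha\in\mathcal F$ of the isomorphism classes $\alpha$ of objects of $\underline{\mathcal F}$, the family $([M_\alpha])_\alpha$ is a basis of the left module and also a basis of the right module. -/

import Mathlib

open CategoryTheory CategoryTheory.Limits

universe w v u

noncomputable section

namespace SemiDerived

/-! ## Exact categories in the sense of Quillen -/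

section

variable {F : Type u} [Category.{v} F] [Preadditive F]

/-- `i` is the first map of a member of the given class of short complexes. -/
def IsInflation (conf : ShortComplex F → Prop) {A B : F} (i : A ⟶ B) : Prop :=
  ∃ (C : F) (p : B ⟶ C) (h : i ≫ p = 0), conf (ShortComplex.mk i p h)

/-- `p` is the second map of a member of the given class of short complexes. -/
def IsDeflation (conf : ShortComplex F → Prop) {B C : F} (p : B ⟶ C) : Prop :=
  ∃ (A : F) (i : A ⟶ B) (h : i ≫ p = 0), conf (ShortComplex.mk i p h)

end

/-- A Quillen exact structure on an additive category: an isomorphism-closed class of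
kernel-cokernel pairs `A ⟶ B ⟶ C`, called conflations, subject to the usual axioms. The first
maps of conflations are the inflations (admissible monomorphisms), the second maps are the
deflations (admissible epimorphisms). -/
structure ExactStructure (F : Type u) [Category.{v} F] [Preadditive F] where
  /-- The class of conflations. -/
  conflation : ShortComplex F → Prop
  of_iso : ∀ {S S' : ShortComplex F}, (S ≅ S') → conflation S → conflation S'
  /-- In a conflation the first map is a kernel of the second one. -/
  isKernel : ∀ {S : ShortComplex F}, conflation S →
    Nonempty (IsLimit (KernelFork.ofι S.f S.zero))
  /-- In a conflation the second map is a cokernel of the first one. -/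
  isCokernel : ∀ {S : ShortComplex F}, conflation S →
    Nonempty (IsColimit (CokernelCofork.ofπ S.g S.zero))
  id_inflation : ∀ A : F, IsInflation conflation (𝟙 A)
  id_deflation : ∀ A : F, IsDeflation conflation (𝟙 A)
  comp_inflation : ∀ {A B C : F} (i : A ⟶ B) (j : B ⟶ C),
    IsInflation conflation i → IsInflation conflation j → IsInflation conflation (i ≫ j)
  comp_deflation : ∀ {A B C : F} (p : A ⟶ B) (q : B ⟶ C),
    IsDeflation conflation p → IsDeflation conflation q → IsDeflation conflation (p ≫ q)
  /-- Push-outs of inflations along arbitrary maps exist and are inflations. -/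
  pushout : ∀ {A B A' : F} (i : A ⟶ B) (f : A ⟶ A'), IsInflation conflation i →
    ∃ (B' : F) (g : B ⟶ B') (i' : A' ⟶ B'), IsPushout i f g i' ∧ IsInflation conflation i'
  /-- Pull-backs of deflations along arbitrary maps exist and are deflations. -/
  pullback : ∀ {B C C' : F} (p : B ⟶ C) (f : C' ⟶ C), IsDeflation conflation p →
    ∃ (B' : F) (g : B' ⟶ B) (p' : B' ⟶ C'), IsPullback g p' p f ∧ IsDeflation conflation p'

/-- The set of isomorphism classes of objects of a category. -/
abbrev IsoClasses (F : Type u) [Category.{v} F] : Type u := Quotient (isIsomorphicSetoid F)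

/-- The isomorphism class of an object. -/
abbrev isoClass {F : Type u} [Category.{v} F] (A : F) : IsoClasses F :=
  Quotient.mk (isIsomorphicSetoid F) A

section

variable {F : Type u} [Category.{v} F] [Preadditive F] (E : ExactStructure F)

/-! ## First extension groups (as sets of Yoneda classes) -/

/-- An extension of `A` by `C`: a conflation `C ⟶ mid ⟶ A`. -/
structure Extension (A C : F) where
  /-- The middle term. -/
  mid : F
  /-- The inflation. -/
  i : C ⟶ mid
  /-- The deflation. -/
  p : mid ⟶ A
  zero : i ≫ p = 0
  conf : E.conflation (ShortComplex.mk i p zero)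

/-- Two extensions are equivalent when their middle terms are isomorphic compatibly with the
identities of the outer terms. -/
instance extensionSetoid (A C : F) : Setoid (Extension E A C) where
  r e e' := ∃ φ : e.mid ≅ e'.mid, e.i ≫ φ.hom = e'.i ∧ φ.hom ≫ e'.p = e.p
  iseqv :=
    { refl := fun e => ⟨Iso.refl _, by simp, by simp⟩
      symm := by
        rintro e e' ⟨φ, h₁, h₂⟩
        exact ⟨φ.symm, by simp [← h₁], by simp [← h₂]⟩
      trans := by
        rintro e e' e'' ⟨φ, h₁, h₂⟩ ⟨ψ, h₃, h₄⟩
        exact ⟨φ ≪≫ ψ, by simp [← h₃, ← h₁], by simp [h₄, h₂]⟩ }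

/-- `Ext¹(A, C)`: equivalence classes of conflations `C ⟶ B ⟶ A`. -/
def Ext1 (A C : F) : Type (max u v) := Quotient (extensionSetoid E A C)

variable {E} in
/-- The isomorphism class of the middle term of an extension class. -/
def Ext1.mid {A C : F} (ξ : Ext1 E A C) : IsoClasses F :=
  Quotient.lift (fun e : Extension E A C => isoClass e.mid)
    (by rintro e e' ⟨φ, -, -⟩; exact Quotient.sound ⟨φ⟩) ξ

variable {E} in
/-- Transport of extensions along isomorphisms of the outer terms. -/
def Extension.map {A A' C C' : F} (a : A ≅ A') (c : C ≅ C') (e : Extension E A C) :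
    Extension E A' C' where
  mid := e.mid
  i := c.inv ≫ e.i
  p := e.p ≫ a.hom
  zero := by simp [reassoc_of% e.zero]
  conf := E.of_iso
    (S := ShortComplex.mk e.i e.p e.zero)
    (ShortComplex.isoMk c (Iso.refl _) a (by simp) (by simp)) e.conf

/-- Transport of extension classes along isomorphisms of the outer terms. -/
def Ext1.congr {A A' C C' : F} (a : A ≅ A') (c : C ≅ C') : Ext1 E A C ≃ Ext1 E A' C' where
  toFun := Quotient.map (Extension.map a c) (by
    rintro e e' ⟨φ, h₁, h₂⟩
    exact ⟨φ, by simp [Extension.map, ← h₁], by simp [Extension.map, ← h₂]⟩)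
  invFun := Quotient.map (Extension.map a.symm c.symm) (by
    rintro e e' ⟨φ, h₁, h₂⟩
    exact ⟨φ, by simp [Extension.map, ← h₁], by simp [Extension.map, ← h₂]⟩)
  left_inv := by
    rintro ⟨e⟩
    exact Quotient.sound ⟨Iso.refl _, by simp [Extension.map],
      by simp [Extension.map]⟩
  right_inv := by
    rintro ⟨e⟩
    exact Quotient.sound ⟨Iso.refl _, by simp [Extension.map],
      by simp [Extension.map]⟩

theorem Ext1.mid_congr {A A' C C' : F} (a : A ≅ A') (c : C ≅ C') (ξ : Ext1 E A C) :
    (Ext1.congr E a c ξ).mid = ξ.mid := by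
  obtain ⟨e⟩ := ξ
  rfl

/-! ## The Hall algebra -/

/-- The rational number `|Ext¹(A, C)_B| / |Hom(A, C)|`, where `b` is the isomorphism class of
`B`. -/
def hallCoeffObj (A C : F) (b : IsoClasses F) : ℚ :=
  (Nat.card {ξ : Ext1 E A C // ξ.mid = b} : ℚ) / (Nat.card (A ⟶ C) : ℚ)

/-- The structure constants `|Ext¹(A, C)_B| / |Hom(A, C)|` as a function of isomorphism
classes. -/
def hallCoeff (a c b : IsoClasses F) : ℚ :=
  Quotient.lift₂ (fun A C : F => hallCoeffObj E A C b) (by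
    rintro A C A' C' ⟨x⟩ ⟨y⟩
    have h₁ : Nat.card {ξ : Ext1 E A C // ξ.mid = b} =
        Nat.card {ξ : Ext1 E A' C' // ξ.mid = b} :=
      Nat.card_congr ((Ext1.congr E x y).subtypeEquiv
        (fun ξ => by rw [Ext1.mid_congr]))
    have h₂ : Nat.card (A ⟶ C) = Nat.card (A' ⟶ C') :=
      Nat.card_congr (x.homCongr y)
    simp only [hallCoeffObj, h₁, h₂]) a c

/-- The underlying vector space of the Hall algebra: the `ℚ`-vector space with basis the set of
isomorphism classes of objects. -/
abbrev Hall (F : Type u) [Category.{v} F] : Type u := IsoClasses F →₀ ℚ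

/-- The product `[A] ⋄ [C] = ∑_B |Ext¹(A, C)_B| / |Hom(A, C)| [B]` of two basis elements. When all
`Ext¹(A, C)` are finite, this is a finite sum. -/
def hallBasisMul (a c : IsoClasses F) : Hall F :=
  ∑ᶠ b : IsoClasses F, Finsupp.single b (hallCoeff E a c b)

/-- The Hall product, as a bilinear map. -/
def hallMul : Hall F →ₗ[ℚ] Hall F →ₗ[ℚ] Hall F :=
  Finsupp.linearCombination ℚ fun a => Finsupp.linearCombination ℚ fun c => hallBasisMul E a c

/-! ## Projective and injective objects, Frobenius categories -/

/-- `P` is projective when `Ext¹(P, X) = 0` for every `X`. -/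
def IsProjective (P : F) : Prop := ∀ X : F, Subsingleton (Ext1 E P X)

/-- `I` is injective when `Ext¹(X, I) = 0` for every `X`. -/
def IsInjective (I : F) : Prop := ∀ X : F, Subsingleton (Ext1 E X I)

/-- A Frobenius exact structure: there are enough projectives and enough injectives, and an object
is projective if and only if it is injective. -/
structure IsFrobenius : Prop where
  enough_projectives : ∀ A : F, ∃ (K P : F) (i : K ⟶ P) (p : P ⟶ A) (h : i ≫ p = 0),
    E.conflation (ShortComplex.mk i p h) ∧ IsProjective E P
  enough_injectives : ∀ A : F, ∃ (I C : F) (i : A ⟶ I) (p : I ⟶ C) (h : i ≫ p = 0),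
    E.conflation (ShortComplex.mk i p h) ∧ IsInjective E I
  projective_iff_injective : ∀ A : F, IsProjective E A ↔ IsInjective E A

/-- The objects of `𝒫(F)`: the projective-injective objects. -/
def ProjInj : Type u := {P : F // IsProjective E P ∧ IsInjective E P}

/-! ## The stable category -/

/-- Two parallel maps are identified in the stable category when their difference factors through
a projective-injective object. -/
def stableRel : HomRel F := fun A B f g =>
  ∃ (P : ProjInj E) (x : A ⟶ P.1) (y : P.1 ⟶ B), f - g = x ≫ y

/-- The stable category: same objects, maps modulo those which factor through a
projective-injective object. -/
abbrev Stable : Type u := CategoryTheory.Quotient (stableRel E)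

/-- The isomorphism class of (the image of) an object in the stable category. -/
def stableClass (M : F) : IsoClasses (Stable E) :=
  isoClass ((CategoryTheory.Quotient.functor (stableRel E)).obj M)

/-! ## The Grothendieck group of projective-injectives and the Euler form -/

/-- The relations `[B] = [A] + [C]` for conflations `A ⟶ B ⟶ C` with terms in `𝒫(F)`. -/
def K0Relations : AddSubgroup (FreeAbelianGroup (ProjInj E)) :=
  AddSubgroup.closure
    {x | ∃ (A B C : ProjInj E) (i : A.1 ⟶ B.1) (p : B.1 ⟶ C.1) (h : i ≫ p = 0),
      E.conflation (ShortComplex.mk i p h) ∧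
      x = FreeAbelianGroup.of B - FreeAbelianGroup.of A - FreeAbelianGroup.of C}

/-- `K₀(𝒫(F))`: the Grothendieck group of the exact category of projective-injectives. -/
def K0P : Type u := FreeAbelianGroup (ProjInj E) ⧸ K0Relations E

instance : AddCommGroup (K0P E) :=
  inferInstanceAs (AddCommGroup (FreeAbelianGroup (ProjInj E) ⧸ K0Relations E))

/-- The class of a projective-injective object in `K₀(𝒫(F))`. -/
def K0P.of (P : ProjInj E) : K0P E :=
  QuotientAddGroup.mk' (K0Relations E) (FreeAbelianGroup.of P)

section Euler

/-- The canonical conflation `A ⟶ A ⊞ C ⟶ C`. -/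
theorem conflation_biprod [HasBinaryBiproducts F] (A C : F) :
    E.conflation (ShortComplex.mk (biprod.inl : A ⟶ A ⊞ C) biprod.snd (by simp)) := by
  obtain ⟨K, f, h0, hS⟩ := E.id_deflation C
  obtain ⟨hk⟩ := E.isKernel hS
  have hf : f = 0 := by simpa using h0
  have h1 : 𝟙 K = 0 := Fork.IsLimit.hom_ext hk (by simp [hf])
  have hK : IsZero K := (IsZero.iff_id_eq_zero K).2 h1
  obtain ⟨B, g, i, hpo, D, p, hp, hconf⟩ := E.pushout f (0 : K ⟶ A) ⟨_, _, _, hS⟩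
  -- `B` is a coproduct of `A` and `C`
  obtain ⟨hc⟩ := E.isCokernel hconf
  let toB : A ⊞ C ⟶ B := biprod.desc i g
  let ofB : B ⟶ A ⊞ C := hpo.desc biprod.inr biprod.inl (hK.eq_of_src _ _)
  have e1 : g ≫ ofB = biprod.inr := hpo.inl_desc _ _ _
  have e2 : i ≫ ofB = biprod.inl := hpo.inr_desc _ _ _
  let eB : B ≅ A ⊞ C :=
    { hom := ofB
      inv := toB
      hom_inv_id := hpo.hom_ext (by simp [reassoc_of% e1, toB]) (by simp [reassoc_of% e2, toB])
      inv_hom_id := by ext <;> simp [toB, e1, e2] }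
  let q : B ⟶ C := ofB ≫ biprod.snd
  have hq : i ≫ q = 0 := by simp [q, reassoc_of% e2]
  let dC : D ⟶ C := Cofork.IsColimit.desc hc q (by simpa using hq)
  have hd : p ≫ dC = q := Cofork.IsColimit.π_desc' hc q _
  let eC : D ≅ C :=
    { hom := dC
      inv := g ≫ p
      hom_inv_id := by
        refine Cofork.IsColimit.hom_ext hc ?_
        change p ≫ dC ≫ g ≫ p = p ≫ 𝟙 D
        rw [reassoc_of% hd]
        refine hpo.hom_ext ?_ ?_
        · simp [q, reassoc_of% e1]
        · simp [reassoc_of% hq, hp]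
      inv_hom_id := by
        rw [Category.assoc, hd]
        simp [q, reassoc_of% e1] }
  exact E.of_iso (S := ShortComplex.mk i p hp)
    (ShortComplex.isoMk (Iso.refl _) eB eC (by simp [eB, e2]) (by simp [eB, eC, hd, q])) hconf

variable {E} in
/-- The middle term of a conflation ending in a projective object is the direct sum of the outer
terms. -/
theorem IsProjective.split [HasBinaryBiproducts F] {A B C : F} (hC : IsProjective E C)
    (i : A ⟶ B) (p : B ⟶ C) (h : i ≫ p = 0) (hc : E.conflation (ShortComplex.mk i p h)) :
    Nonempty (B ≅ A ⊞ C) := by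
  let e : Extension E C A := ⟨B, i, p, h, hc⟩
  let e' : Extension E C A := ⟨_, _, _, _, conflation_biprod E A C⟩
  have := (hC A).elim (Quotient.mk _ e) (Quotient.mk _ e')
  obtain ⟨φ, -, -⟩ := Quotient.exact this
  exact ⟨φ⟩

variable [∀ A B : F, Finite (A ⟶ B)]

/-- The number `|Hom(A, B)|`, as a nonzero rational number. -/
def homCard (A B : F) : ℚˣ :=
  Units.mk0 (Nat.card (A ⟶ B) : ℚ) (by
    have : Nonempty (A ⟶ B) := ⟨0⟩
    exact_mod_cast Nat.card_pos.ne')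

theorem homCard_biprod_left [HasBinaryBiproducts F] (A C X B : F) (e : B ≅ A ⊞ C) :
    homCard B X = homCard A X * homCard C X := by
  ext
  simp only [homCard, Units.val_mk0, Units.val_mul]
  rw [← Nat.cast_mul, ← Nat.card_prod]
  congr 1
  exact Nat.card_congr
    { toFun := fun f => (biprod.inl ≫ e.inv ≫ f, biprod.inr ≫ e.inv ≫ f)
      invFun := fun f => e.hom ≫ biprod.desc f.1 f.2
      left_inv := fun f => by
        rw [← cancel_epi e.inv]
        ext <;> simp
      right_inv := fun f => by simp }

theorem homCard_biprod_right [HasBinaryBiproducts F] (A C X B : F) (e : B ≅ A ⊞ C) :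
    homCard X B = homCard X A * homCard X C := by
  ext
  simp only [homCard, Units.val_mk0, Units.val_mul]
  rw [← Nat.cast_mul, ← Nat.card_prod]
  congr 1
  exact Nat.card_congr
    { toFun := fun f => (f ≫ e.hom ≫ biprod.fst, f ≫ e.hom ≫ biprod.snd)
      invFun := fun f => biprod.lift f.1 f.2 ≫ e.inv
      left_inv := fun f => by
        rw [← cancel_mono e.hom]
        ext <;> simp
      right_inv := fun f => by simp }

variable [HasBinaryBiproducts F]

/-- The homomorphism `⟨P, -⟩ : K₀(𝒫(F)) → ℚˣ`. -/
def eulerRight (P : ProjInj E) : K0P E →+ Additive ℚˣ :=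
  QuotientAddGroup.lift (K0Relations E)
    (FreeAbelianGroup.lift fun Q : ProjInj E => Additive.ofMul (homCard P.1 Q.1)) (by
      rw [K0Relations, AddSubgroup.closure_le]
      rintro _ ⟨A, B, C, i, p, h, hc, rfl⟩
      obtain ⟨e⟩ := C.2.1.split i p h hc
      have := homCard_biprod_right A.1 C.1 P.1 B.1 e
      simp [this])

theorem eulerRight_of (P Q : ProjInj E) :
    eulerRight E P (K0P.of E Q) = Additive.ofMul (homCard P.1 Q.1) := by
  change FreeAbelianGroup.lift _ (FreeAbelianGroup.of Q) = _
  rw [FreeAbelianGroup.lift_apply_of]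

/-- The Euler form `⟨-, -⟩ : K₀(𝒫(F)) × K₀(𝒫(F)) → ℚˣ`, the biadditive map with
`⟨P, Q⟩ = |Hom(P, Q)|` for projective-injective objects `P` and `Q`. -/
def euler : K0P E →+ K0P E →+ Additive ℚˣ :=
  QuotientAddGroup.lift (K0Relations E)
    (FreeAbelianGroup.lift (eulerRight E)) (by
      rw [K0Relations, AddSubgroup.closure_le]
      rintro _ ⟨A, B, C, i, p, h, hc, rfl⟩
      obtain ⟨e⟩ := C.2.1.split i p h hc
      have key : eulerRight E B = eulerRight E A + eulerRight E C := by
        refine QuotientAddGroup.addMonoidHom_ext _ (FreeAbelianGroup.lift_ext _ _ fun Q => ?_)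
        have := homCard_biprod_left A.1 C.1 Q.1 B.1 e
        change eulerRight E B (K0P.of E Q) =
          eulerRight E A (K0P.of E Q) + eulerRight E C (K0P.of E Q)
        simp only [eulerRight_of, this, ofMul_mul]
      simp [key])

/-- The value `⟨a, b⟩ ∈ ℚˣ` of the Euler form. -/
def eulerForm (a b : K0P E) : ℚˣ := (euler E a b).toMul

theorem eulerForm_of (P Q : ProjInj E) :
    eulerForm E (K0P.of E P) (K0P.of E Q) = homCard P.1 Q.1 := by
  have : euler E (K0P.of E P) = eulerRight E P := by
    change FreeAbelianGroup.lift _ (FreeAbelianGroup.of P) = _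
    rw [FreeAbelianGroup.lift_apply_of]
  rw [eulerForm, this, eulerRight_of, toMul_ofMul]

end Euler

/-! ## The quantum torus -/

section Torus

/-- The quantum torus of projective-injectives: the `ℚ`-vector space with basis `K₀(𝒫(F))`,
with the multiplication `[a] [b] = ⟨a, b⟩⁻¹ [a + b]` twisted by the Euler form. -/
def QuantumTorus : Type u := K0P E →₀ ℚ

instance : AddCommGroup (QuantumTorus E) := inferInstanceAs (AddCommGroup (K0P E →₀ ℚ))

instance : Module ℚ (QuantumTorus E) := inferInstanceAs (Module ℚ (K0P E →₀ ℚ))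

namespace QuantumTorus

/-- The basis element of the quantum torus attached to an element of `K₀(𝒫(F))`. -/
def of (a : K0P E) : QuantumTorus E := Finsupp.single a (1 : ℚ)

theorem induction {p : QuantumTorus E → Prop} (x : QuantumTorus E)
    (zero : p 0) (add : ∀ x y, p x → p y → p (x + y)) (of : ∀ (c : ℚ) a, p (c • of E a)) : p x := by
  refine Finsupp.induction_linear x zero add fun a c => ?_
  have := of c a
  simp only [QuantumTorus.of] at this
  erw [Finsupp.smul_single_one] at this
  exact this

variable [∀ A B : F, Finite (A ⟶ B)] [HasBinaryBiproducts F]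

/-- The twisted multiplication, as a bilinear map. -/
def mul : QuantumTorus E →ₗ[ℚ] QuantumTorus E →ₗ[ℚ] QuantumTorus E :=
  Finsupp.linearCombination ℚ fun a => Finsupp.linearCombination ℚ fun b =>
    (((eulerForm E a b)⁻¹ : ℚˣ) : ℚ) • of E (a + b)

theorem mul_of_of (a b : K0P E) :
    mul E (of E a) (of E b) = (((eulerForm E a b)⁻¹ : ℚˣ) : ℚ) • of E (a + b) := by
  simp only [mul, of]
  erw [Finsupp.linearCombination_single, one_smul, Finsupp.linearCombination_single, one_smul]

theorem mul_assoc' (x y z : QuantumTorus E) : mul E (mul E x y) z = mul E x (mul E y z) := by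
  induction x using induction with
  | zero => simp
  | add x x' hx hx' => simp [hx, hx']
  | of c a =>
    induction y using induction with
    | zero => simp
    | add x x' hx hx' => simp only [map_add, LinearMap.add_apply, hx, hx']
    | of d b =>
      induction z using induction with
      | zero => simp
      | add x x' hx hx' => simp only [map_add, hx, hx']
      | of e g =>
        simp only [map_smul, LinearMap.smul_apply, mul_of_of, smul_smul, add_assoc]
        congr 1
        simp only [eulerForm, map_add, AddMonoidHom.add_apply, toMul_add, mul_inv, Units.val_mul]
        ring

theorem one_mul' (x : QuantumTorus E) : mul E (of E 0) x = x := by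
  induction x using induction with
  | zero => simp
  | add x x' hx hx' => simp [hx, hx']
  | of c a => simp [mul_of_of, eulerForm]

theorem mul_one' (x : QuantumTorus E) : mul E x (of E 0) = x := by
  induction x using induction with
  | zero => simp
  | add x x' hx hx' => simp [hx, hx']
  | of c a => simp [mul_of_of, eulerForm]

instance : Ring (QuantumTorus E) where
  __ := (inferInstance : AddCommGroup (QuantumTorus E))
  mul x y := mul E x y
  one := of E 0
  mul_assoc := mul_assoc' E
  one_mul := one_mul' E
  mul_one := mul_one' E
  zero_mul x := by change mul E 0 x = 0; simp
  mul_zero x := by change mul E x 0 = 0; simp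
  left_distrib x y z := by change mul E x (y + z) = mul E x y + mul E x z; simp
  right_distrib x y z := by change mul E (x + y) z = mul E x z + mul E y z; simp

instance : Algebra ℚ (QuantumTorus E) :=
  Algebra.ofModule (fun c x y => by change mul E (c • x) y = c • mul E x y; simp)
    (fun c x y => by change mul E x (c • y) = c • mul E x y; simp)

end QuantumTorus

end Torus

/-! ## The semi-derived Hall algebra -/

section SDH

open scoped ZeroObject

variable [HasZeroObject F]

/-- The free algebra on symbols for the basis elements of the Hall algebra and for the inverses of
the classes of projective-injective objects. -/
abbrev SDHFree : Type u := FreeAlgebra ℚ (IsoClasses F ⊕ ProjInj E)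

/-- The linear map from the Hall algebra to the free algebra sending `[A]` to its symbol. -/
def hallSymbol : Hall F →ₗ[ℚ] SDHFree E :=
  Finsupp.linearCombination ℚ fun a => FreeAlgebra.ι ℚ (Sum.inl a)

/-- The relations defining the localization: the unit and the product are those of the Hall
algebra, and the classes of projective-injective objects have two-sided inverses. -/
inductive SDHRel : SDHFree E → SDHFree E → Prop
  | one : SDHRel (hallSymbol E (Finsupp.single (isoClass (0 : F)) 1)) 1
  | mul (x y : Hall F) : SDHRel (hallSymbol E x * hallSymbol E y) (hallSymbol E (hallMul E x y))
  | mul_inv (P : ProjInj E) : SDHRel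
      (hallSymbol E (Finsupp.single (isoClass P.1) 1) * FreeAlgebra.ι ℚ (Sum.inr P)) 1
  | inv_mul (P : ProjInj E) : SDHRel
      (FreeAlgebra.ι ℚ (Sum.inr P) * hallSymbol E (Finsupp.single (isoClass P.1) 1)) 1

/-- The semi-derived Hall algebra: the localization of the Hall algebra at the classes of all
projective-injective objects, i.e. the universal `ℚ`-algebra with a homomorphism from the Hall
algebra which makes these classes invertible. -/
def SDH : Type u := RingQuot (SDHRel E)

instance : Ring (SDH E) := inferInstanceAs (Ring (RingQuot (SDHRel E)))

instance : Algebra ℚ (SDH E) := inferInstanceAs (Algebra ℚ (RingQuot (SDHRel E)))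

/-- The class `[M]` of an object in the semi-derived Hall algebra. -/
def SDH.cls (M : F) : SDH E :=
  RingQuot.mkAlgHom ℚ (SDHRel E) (hallSymbol E (Finsupp.single (isoClass M) 1))

end SDH

/-! ## The actions of the quantum torus on the semi-derived Hall algebra -/

section Action

variable {T S : Type*} [Ring T] [Ring S] [Algebra ℚ T] [Algebra ℚ S]

/-- The left action of `T` on `S` through `φ`: `t • x = φ t * x`. -/
abbrev leftAction (φ : T →ₐ[ℚ] S) : Module T S := Module.compHom S φ.toRingHom

/-- The right action of `T` on `S` through `φ`: `x • t = x * φ t`. -/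
abbrev rightAction (φ : T →ₐ[ℚ] S) : Module Tᵐᵒᵖ S := Module.compHom S φ.toRingHom.op

end Action

end

end SemiDerived

end

open SemiDerived

namespace SemiDerived

/-! ## Conflations as pairs of maps -/

section Exact

variable {F : Type u} [Category.{v} F] [Preadditive F] (E : ExactStructure F)

/-! The core of the argument is a `ℚ`-basis of the semi-derived Hall algebra, consisting of the
products of the image of `t_a` with `[M_α]`, for `a` in `K₀` and `α` a stable isomorphism class.
Since the `t_a` form a `ℚ`-basis of the torus, such a product basis makes the `[M_α]` a basis over
the torus (`exists_basis_of_basis_smul`).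

If `P` is projective-injective, every extension between `P` and `A` splits, in either order. Hence
`[P]` and `[A]` multiply to a nonzero multiple of `[P ⊕ A]`, and they commute up to a nonzero
scalar. Modulo scalars, all computations with the `[P]` therefore take place in the monoid of
isomorphism classes under direct sum. Two facts about this monoid carry the proof. It is
cancellative (`isoClass_add_left_cancel`), because Hom sets are finite and idempotents split.
Objects are stably isomorphic exactly when they become isomorphic after adding projective-injectives
(`stableClass_eq_iff`).

Cancellation makes multiplication by `[P]` injective on the Hall algebra, whose associativity is a
count of diagrams of conflations (`sum_hallCoeff_mul`). The classes `[P]`, up to scalars, then form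
an Ore set of non-zero-divisors. The Hall algebra embeds in its Ore localization, and so, by the
universal property, in the semi-derived Hall algebra (`SDH.ofHall_injective`).

The products span by the description of stable isomorphism (`span_translates`). For independence,
multiplying finitely many of them by a common denominator `[R]` gives nonzero multiples of classes
of pairwise non-isomorphic objects (`linearIndependent_translates`). The right-hand version follows
because the factors commute up to nonzero scalars. -/

/-- The pair of maps `(i, p)` is a conflation. -/
def IsConf {A B C : F} (i : A ⟶ B) (p : B ⟶ C) : Prop :=
  ∃ w : i ≫ p = 0, E.conflation (ShortComplex.mk i p w)

variable {E}

namespace IsConf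

variable {A B C : F} {i : A ⟶ B} {p : B ⟶ C}

theorem zero (h : IsConf E i p) : i ≫ p = 0 := h.1

theorem isInflation (h : IsConf E i p) : IsInflation E.conflation i := ⟨_, p, h⟩

theorem isDeflation (h : IsConf E i p) : IsDeflation E.conflation p := ⟨_, i, h⟩

theorem mono (h : IsConf E i p) : Mono i := by
  obtain ⟨w, h⟩ := h
  obtain ⟨hk⟩ := E.isKernel h
  exact ⟨fun f g hfg => Fork.IsLimit.hom_ext hk hfg⟩

theorem epi (h : IsConf E i p) : Epi p := by
  obtain ⟨w, h⟩ := h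
  obtain ⟨hk⟩ := E.isCokernel h
  exact ⟨fun f g hfg => Cofork.IsColimit.hom_ext hk hfg⟩

theorem exists_lift (h : IsConf E i p) {X : F} (f : X ⟶ B) (hf : f ≫ p = 0) :
    ∃ g : X ⟶ A, g ≫ i = f := by
  obtain ⟨w, h⟩ := h
  obtain ⟨hk⟩ := E.isKernel h
  obtain ⟨g, hg⟩ := KernelFork.IsLimit.lift' hk f hf
  exact ⟨g, hg⟩

theorem exists_desc (h : IsConf E i p) {X : F} (f : B ⟶ X) (hf : i ≫ f = 0) :
    ∃ g : C ⟶ X, p ≫ g = f := by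
  obtain ⟨w, h⟩ := h
  obtain ⟨hk⟩ := E.isCokernel h
  obtain ⟨g, hg⟩ := CokernelCofork.IsColimit.desc' hk f hf
  exact ⟨g, hg⟩

theorem of_iso (h : IsConf E i p) {A' B' C' : F} {i' : A' ⟶ B'} {p' : B' ⟶ C'} (a : A ≅ A')
    (b : B ≅ B') (c : C ≅ C') (h₁ : a.hom ≫ i' = i ≫ b.hom) (h₂ : b.hom ≫ p' = p ≫ c.hom) :
    IsConf E i' p' := by
  obtain ⟨w, h⟩ := h
  have w' : i' ≫ p' = 0 := by
    rw [← cancel_epi a.hom, reassoc_of% h₁, h₂, reassoc_of% w, zero_comp, comp_zero]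
  exact ⟨w', E.of_iso (S := ShortComplex.mk i p w) (ShortComplex.isoMk a b c h₁ h₂) h⟩

/-- A deflation and a kernel of it form a conflation. -/
theorem of_isDeflation (hp : IsDeflation E.conflation p) (w : i ≫ p = 0) (hi : Mono i)
    (hl : ∀ {X : F} (f : X ⟶ B), f ≫ p = 0 → ∃ g, g ≫ i = f) : IsConf E i p := by
  obtain ⟨K, k, hk⟩ := hp
  replace hk : IsConf E k p := hk
  have := hk.mono
  obtain ⟨a, ha⟩ := hl k hk.zero
  obtain ⟨b, hb⟩ := hk.exists_lift i w
  refine hk.of_iso ⟨a, b, ?_, ?_⟩ (Iso.refl _) (Iso.refl _) (by simp [ha]) (by simp)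
  · rw [← cancel_mono k]; simp [hb, ha]
  · rw [← cancel_mono i]; simp [hb, ha]

/-- An inflation and a cokernel of it form a conflation. -/
theorem of_isInflation (hi : IsInflation E.conflation i) (w : i ≫ p = 0) (hp : Epi p)
    (hl : ∀ {X : F} (f : B ⟶ X), i ≫ f = 0 → ∃ g, p ≫ g = f) : IsConf E i p := by
  obtain ⟨K, k, hk⟩ := hi
  replace hk : IsConf E i k := hk
  have := hk.epi
  obtain ⟨a, ha⟩ := hl k hk.zero
  obtain ⟨b, hb⟩ := hk.exists_desc p w
  refine hk.of_iso (Iso.refl _) (Iso.refl _) ⟨b, a, ?_, ?_⟩ (by simp) (by simp [hb])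
  · rw [← cancel_epi k]; simp [reassoc_of% hb, ha]
  · rw [← cancel_epi p]; simp [reassoc_of% ha, hb]

/-- The short five lemma. -/
theorem isIso {B' : F} {i' : A ⟶ B'} {p' : B' ⟶ C} (h : IsConf E i p) (h' : IsConf E i' p')
    (φ : B' ⟶ B) (h₁ : i' ≫ φ = i) (h₂ : φ ≫ p = p') : IsIso φ := by
  obtain ⟨Q, g, q, hpb, K, n, hn⟩ := E.pullback p' p h'.isDeflation
  replace hn : IsConf E n q := hn
  have := hn.epi
  have := h.mono
  have := h'.mono
  -- In terms of elements, the inverse sends `b` to `b' + i' (i⁻¹ (b - φ b'))`, where `b'` is any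
  -- lift of `p b` along `p'`. The pull-back `Q` consists of the pairs `(b', b)`, and independence
  -- of `b'` is the descent along `q`.
  obtain ⟨c, hc⟩ := h.exists_lift (q - g ≫ φ) (by simp [h₂, hpb.w])
  obtain ⟨r, hr⟩ := hn.exists_desc (c ≫ i' + g) (by
    obtain ⟨m, hm⟩ := h'.exists_lift (n ≫ g) (by
      rw [Category.assoc, hpb.w, reassoc_of% hn.zero, zero_comp])
    have : n ≫ c = -m := by
      rw [← cancel_mono i, Category.assoc, hc, Preadditive.comp_sub, hn.zero, ← reassoc_of% hm, h₁]
      simp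
    rw [Preadditive.comp_add, reassoc_of% this, ← hm]
    simp)
  -- The graph `b' ↦ (b', φ b')`; on it the correction term `c` vanishes.
  obtain ⟨s, hs₁, hs₂⟩ : ∃ s : B' ⟶ Q, s ≫ g = 𝟙 _ ∧ s ≫ q = φ :=
    ⟨hpb.lift (𝟙 _) φ (by simp [h₂]), by simp, by simp⟩
  refine ⟨r, ?_, ?_⟩
  · have : s ≫ c = 0 := by
      rw [← cancel_mono i, Category.assoc, hc]
      simp [hs₂, reassoc_of% hs₁]
    rw [← hs₂, Category.assoc, hr]
    simp [reassoc_of% this, hs₁]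
  · rw [← cancel_epi q, reassoc_of% hr]
    simp [h₁, hc]

end IsConf

/-- The extension class of a conflation. -/
def IsConf.cls {A B C : F} {i : C ⟶ B} {p : B ⟶ A} (h : IsConf E i p) : Ext1 E A C :=
  Quotient.mk _ ⟨B, i, p, h.1, h.2⟩

theorem IsConf.cls_eq_cls_iff {A B B' C : F} {i : C ⟶ B} {p : B ⟶ A} {i' : C ⟶ B'} {p' : B' ⟶ A}
    (h : IsConf E i p) (h' : IsConf E i' p') :
    h.cls = h'.cls ↔ ∃ φ : B ⟶ B', i ≫ φ = i' ∧ φ ≫ p' = p := by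
  constructor
  · intro h
    obtain ⟨φ, h₁, h₂⟩ := Quotient.exact h
    exact ⟨φ.hom, h₁, h₂⟩
  · rintro ⟨φ, h₁, h₂⟩
    have := h'.isIso h φ h₁ h₂
    exact Quotient.sound ⟨asIso φ, h₁, h₂⟩

theorem Ext1.exists_cls_eq {A C : F} (ξ : Ext1 E A C) :
    ∃ (B : F) (i : C ⟶ B) (p : B ⟶ A) (h : IsConf E i p), h.cls = ξ := by
  obtain ⟨e⟩ := ξ
  exact ⟨e.mid, e.i, e.p, ⟨e.zero, e.conf⟩, rfl⟩

/-- The push-out of a conflation. -/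
theorem IsConf.exists_pushout {A B C A' : F} {i : A ⟶ B} {p : B ⟶ C} (h : IsConf E i p)
    (f : A ⟶ A') : ∃ (B' : F) (g : B ⟶ B') (i' : A' ⟶ B') (p' : B' ⟶ C),
      IsPushout i f g i' ∧ g ≫ p' = p ∧ IsConf E i' p' := by
  obtain ⟨B', g, i', hpo, hi'⟩ := E.pushout i f h.isInflation
  have hp₁ : g ≫ hpo.desc p 0 (by simp [h.zero]) = p := hpo.inl_desc _ _ _
  have hp₂ : i' ≫ hpo.desc p 0 (by simp [h.zero]) = 0 := hpo.inr_desc _ _ _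
  have := h.epi
  refine ⟨B', g, i', hpo.desc p 0 (by simp [h.zero]), hpo, hp₁,
    IsConf.of_isInflation hi' hp₂ (epi_of_epi_fac hp₁) fun x hx => ?_⟩
  obtain ⟨y, hy⟩ := h.exists_desc (g ≫ x) (by rw [hpo.w_assoc, hx, comp_zero])
  refine ⟨y, hpo.hom_ext ?_ ?_⟩
  · rw [reassoc_of% hp₁, hy]
  · rw [reassoc_of% hp₂, zero_comp, hx]

/-- The pull-back of a conflation. -/
theorem IsConf.exists_pullback {A B C C' : F} {i : A ⟶ B} {p : B ⟶ C} (h : IsConf E i p)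
    (f : C' ⟶ C) : ∃ (B' : F) (g : B' ⟶ B) (i' : A ⟶ B') (p' : B' ⟶ C'),
      IsPullback g p' p f ∧ i' ≫ g = i ∧ IsConf E i' p' := by
  obtain ⟨B', g, p', hpb, hp'⟩ := E.pullback p f h.isDeflation
  have hi₁ : hpb.lift i 0 (by simp [h.zero]) ≫ g = i := hpb.lift_fst _ _ _
  have hi₂ : hpb.lift i 0 (by simp [h.zero]) ≫ p' = 0 := hpb.lift_snd _ _ _
  have := h.mono
  refine ⟨B', g, hpb.lift i 0 (by simp [h.zero]), p', hpb, hi₁,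
    IsConf.of_isDeflation hp' hi₂ (mono_of_mono_fac hi₁) fun x hx => ?_⟩
  obtain ⟨y, hy⟩ := h.exists_lift (x ≫ g) (by rw [Category.assoc, hpb.w, reassoc_of% hx, zero_comp])
  refine ⟨y, hpb.hom_ext ?_ ?_⟩
  · rw [Category.assoc, hi₁, hy]
  · rw [Category.assoc, hi₂, comp_zero, hx]

/-! ### Splitting and lifting properties of projectives and injectives. -/

section Biproducts

variable [HasBinaryBiproducts F]

theorem isConf_biprod (A C : F) : IsConf E (biprod.inl : A ⟶ A ⊞ C) biprod.snd :=
  ⟨by simp, conflation_biprod E A C⟩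

theorem IsProjective.exists_section {P X Y : F} (hP : IsProjective E P) {i : X ⟶ Y} {p : Y ⟶ P}
    (h : IsConf E i p) : ∃ s : P ⟶ Y, s ≫ p = 𝟙 P := by
  have := (hP X).elim (isConf_biprod X P).cls h.cls
  obtain ⟨φ, -, h₂⟩ := (IsConf.cls_eq_cls_iff _ _).1 this
  exact ⟨biprod.inr ≫ φ, by simp [h₂]⟩

theorem IsInjective.exists_retraction {I X Y : F} (hI : IsInjective E I) {i : I ⟶ Y} {p : Y ⟶ X}
    (h : IsConf E i p) : ∃ r : Y ⟶ I, i ≫ r = 𝟙 I := by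
  have := (hI X).elim h.cls (isConf_biprod I X).cls
  obtain ⟨φ, h₁, -⟩ := (IsConf.cls_eq_cls_iff _ _).1 this
  exact ⟨φ ≫ biprod.fst, by simp [reassoc_of% h₁]⟩

theorem IsProjective.exists_lift {P A B C : F} (hP : IsProjective E P) {i : A ⟶ B} {p : B ⟶ C}
    (h : IsConf E i p) (f : P ⟶ C) : ∃ g : P ⟶ B, g ≫ p = f := by
  obtain ⟨B', g, i', p', hpb, -, h'⟩ := h.exists_pullback f
  obtain ⟨s, hs⟩ := hP.exists_section h'
  exact ⟨s ≫ g, by rw [Category.assoc, hpb.w, reassoc_of% hs]⟩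

theorem IsInjective.exists_desc {I A B C : F} (hI : IsInjective E I) {i : A ⟶ B} {p : B ⟶ C}
    (h : IsConf E i p) (f : A ⟶ I) : ∃ g : B ⟶ I, i ≫ g = f := by
  obtain ⟨B', g, i', p', hpo, -, h'⟩ := h.exists_pushout f
  obtain ⟨s, hs⟩ := hI.exists_retraction h'
  exact ⟨g ≫ s, by rw [hpo.w_assoc, hs, Category.comp_id]⟩

/-- A section of the deflation defines a map from the direct sum to the middle term, and this is an
equivalence with the split extension. -/
theorem isProjective_of_forall_exists_lift {P : F}
    (hP : ∀ {A B : F} (i : A ⟶ B) (p : B ⟶ P), IsConf E i p → ∃ s : P ⟶ B, s ≫ p = 𝟙 P) :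
    IsProjective E P := by
  have key (X : F) (ξ : Ext1 E P X) : (isConf_biprod X P).cls = ξ := by
    obtain ⟨B, i, p, h, rfl⟩ := ξ.exists_cls_eq
    obtain ⟨s, hs⟩ := hP _ _ h
    refine (IsConf.cls_eq_cls_iff _ _).2 ⟨biprod.desc i s, biprod.inl_desc _ _, ?_⟩
    ext <;> simp [h.zero, hs]
  exact fun X => ⟨fun ξ ξ' => (key X ξ).symm.trans (key X ξ')⟩

theorem isProjective_of_isZero {Z : F} (hZ : IsZero Z) : IsProjective E Z :=
  isProjective_of_forall_exists_lift fun _ _ _ => ⟨0, hZ.eq_of_src _ _⟩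

theorem IsProjective.of_retract {P Q : F} (hP : IsProjective E P) (i : Q ⟶ P) (r : P ⟶ Q)
    (h : i ≫ r = 𝟙 Q) : IsProjective E Q :=
  isProjective_of_forall_exists_lift fun _ _ hc => by
    obtain ⟨g, hg⟩ := hP.exists_lift hc r
    exact ⟨i ≫ g, by rw [Category.assoc, hg, h]⟩

theorem IsProjective.biprod {P Q : F} (hP : IsProjective E P) (hQ : IsProjective E Q) :
    IsProjective E (P ⊞ Q) :=
  isProjective_of_forall_exists_lift fun _ _ hc => by
    obtain ⟨g, hg⟩ := hP.exists_lift hc biprod.inl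
    obtain ⟨g', hg'⟩ := hQ.exists_lift hc biprod.inr
    exact ⟨biprod.desc g g', by ext <;> simp [hg, hg']⟩

/-- Every extension of `A` by `C` is a push-out of one fixed conflation `K ⟶ P ⟶ A` with `P`
projective, so the finite set `Hom(K, C)` surjects onto `Ext¹(A, C)`. -/
theorem finite_ext1 (hE : IsFrobenius E) [∀ A B : F, Finite (A ⟶ B)] (A C : F) :
    Finite (Ext1 E A C) := by
  obtain ⟨K, P, k, π, w, hc, hP⟩ := hE.enough_projectives A
  have hc : IsConf E k π := ⟨w, hc⟩
  choose B g i p hpo hg hip using fun f : K ⟶ C => hc.exists_pushout f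
  refine Finite.of_surjective
    (fun f : K ⟶ C => (hip f).cls) fun ξ => ?_
  obtain ⟨B', i', p', h, rfl⟩ := ξ.exists_cls_eq
  obtain ⟨x, hx⟩ := hP.exists_lift h π
  obtain ⟨f, hf⟩ := h.exists_lift (k ≫ x) (by rw [Category.assoc, hx, w])
  refine ⟨f, (IsConf.cls_eq_cls_iff _ _).2
    ⟨(hpo f).desc x i' hf.symm, (hpo f).inr_desc _ _ _, (hpo f).hom_ext ?_ ?_⟩⟩
  · rw [(hpo f).inl_desc_assoc, hx, hg]
  · rw [(hpo f).inr_desc_assoc, h.zero, (hip f).zero]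

end Biproducts

end Exact

end SemiDerived

namespace SemiDerived

/-! ## Counting conflations -/

section Counting

variable {F : Type u} [Category.{v} F] [Preadditive F] (E : ExactStructure F)

/-- The conflations `C ⟶ B ⟶ A` with fixed terms. -/
def Confs (A B C : F) : Type v := {x : (C ⟶ B) × (B ⟶ A) // IsConf E x.1 x.2}

section

variable [∀ A B : F, Finite (A ⟶ B)]

instance finite_confs (A B C : F) : Finite (Confs E A B C) :=
  inferInstanceAs (Finite {x : (C ⟶ B) × (B ⟶ A) // IsConf E x.1 x.2})

theorem card_hom_pos (A B : F) : 0 < Nat.card (A ⟶ B) :=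
  have : Nonempty (A ⟶ B) := ⟨0⟩
  Nat.card_pos

end

theorem card_aut_pos {F : Type u} [Category.{v} F] [∀ A B : F, Finite (A ⟶ B)] (A : F) :
    0 < Nat.card (A ≅ A) :=
  have : Nonempty (A ≅ A) := ⟨Iso.refl A⟩
  have : Finite (A ≅ A) := Finite.of_injective (fun φ => φ.hom) fun _ _ h => Iso.ext h
  Nat.card_pos

/-- Extension classes with middle term `B` are the orbits of `Aut B` on the conflations
`C ⟶ B ⟶ A`, with stabilizers in bijection with `Hom(A, C)`. -/
theorem card_ext1_mul_card_aut (A B C : F) :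
    Nat.card {ξ : Ext1 E A C // ξ.mid = isoClass B} * Nat.card (B ≅ B) =
      Nat.card (Confs E A B C) * Nat.card (A ⟶ C) := by
  have h₁ (ξ : {ξ : Ext1 E A C // ξ.mid = isoClass B}) :
      ∃ x : Confs E A B C, x.2.cls = ξ.1 := by
    obtain ⟨ξ, hξ⟩ := ξ
    obtain ⟨B', i, p, h, rfl⟩ := ξ.exists_cls_eq
    obtain ⟨φ⟩ : Nonempty (B' ≅ B) := Quotient.exact hξ
    have h' : IsConf E (i ≫ φ.hom) (φ.inv ≫ p) :=
      h.of_iso (Iso.refl _) φ (Iso.refl _) (by simp) (by simp)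
    exact ⟨⟨(_, _), h'⟩, (h'.cls_eq_cls_iff h).2 ⟨φ.inv, by simp, by simp⟩⟩
  choose r hr using h₁
  let cl (x : Confs E A B C) : {ξ : Ext1 E A C // ξ.mid = isoClass B} := ⟨x.2.cls, rfl⟩
  have h₂ (x : Confs E A B C) : ∃ φ : B ⟶ B,
      (r (cl x)).1.1 ≫ φ = x.1.1 ∧ φ ≫ x.1.2 = (r (cl x)).1.2 :=
    (IsConf.cls_eq_cls_iff _ x.2).1 (hr (cl x))
  choose φ hφ₁ hφ₂ using h₂
  -- The maps from the chosen representative of the class of `x` to `x`, compatible with the outer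
  -- identities, form a torsor under `Hom(A, C)`. By the five lemma they are all automorphisms of
  -- `B`, and `(x, h) ↦ (class of x, ψ x h)` is the required bijection.
  let ψ (x : Confs E A B C) (h : A ⟶ C) : B ⟶ B := φ x + (r (cl x)).1.2 ≫ h ≫ x.1.1
  have hψ₁ (x h) : (r (cl x)).1.1 ≫ ψ x h = x.1.1 := by
    simp [ψ, hφ₁, reassoc_of% (r (cl x)).2.zero]
  have hψ₂ (x h) : ψ x h ≫ x.1.2 = (r (cl x)).1.2 := by
    simp [ψ, hφ₂, x.2.zero]
  have hψ (x h) : IsIso (ψ x h) := x.2.isIso (r (cl x)).2 _ (hψ₁ x h) (hψ₂ x h)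
  rw [← Nat.card_prod, ← Nat.card_prod]
  refine (Nat.card_congr (Equiv.ofBijective (fun y : Confs E A B C × (A ⟶ C) =>
    (cl y.1, asIso (ψ y.1 y.2))) ⟨?_, ?_⟩)).symm
  · rintro ⟨x, h⟩ ⟨x', h'⟩ heq
    obtain ⟨hc, hi⟩ := Prod.ext_iff.1 heq
    replace hi : ψ x h = ψ x' h' := congrArg Iso.hom hi
    replace hc : cl x = cl x' := hc
    obtain rfl : x = x' := by
      refine Subtype.ext (Prod.ext ?_ ?_)
      · rw [← hψ₁ x h, ← hψ₁ x' h', hc, hi]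
      · rw [← cancel_epi (ψ x h), hψ₂, hi, hψ₂, hc]
    have := (r (cl x)).2.epi
    have := x.2.mono
    simpa [ψ, cancel_epi, cancel_mono] using hi
  · rintro ⟨ξ, θ⟩
    have hx : IsConf E ((r ξ).1.1 ≫ θ.hom) (θ.inv ≫ (r ξ).1.2) :=
      (r ξ).2.of_iso (Iso.refl _) θ (Iso.refl _) (by simp) (by simp)
    let x : Confs E A B C := ⟨(_, _), hx⟩
    have hcl : cl x = ξ := Subtype.ext <| (Eq.trans
      ((hx.cls_eq_cls_iff (r ξ).2).2 ⟨θ.inv, by simp, by simp⟩) (hr ξ))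
    -- The difference of two such maps vanishes on `C` and becomes zero in `A`, so it comes from a
    -- map `A ⟶ C`.
    obtain ⟨y, hy⟩ := (r ξ).2.exists_desc (θ.hom - φ x) (by
      rw [Preadditive.comp_sub, sub_eq_zero, ← hcl, hφ₁, hcl])
    have := (r ξ).2.epi
    obtain ⟨h, hh⟩ := x.2.exists_lift y (by
      rw [← cancel_epi (r ξ).1.2, reassoc_of% hy, Preadditive.sub_comp, hφ₂, hcl]
      simp [x])
    refine ⟨(x, h), Prod.ext hcl (Iso.ext ?_)⟩
    change φ x + (r (cl x)).1.2 ≫ h ≫ x.1.1 = θ.hom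
    rw [hcl, hh, hy, add_sub_cancel]

variable [∀ A B : F, Finite (A ⟶ B)]

/-- This form contains neither `Ext` nor `Hom(A, C)`, only conflations with fixed terms, which is
what makes associativity a counting problem. -/
theorem hallCoeff_eq (a c b : IsoClasses F) :
    hallCoeff E a c b = (Nat.card (Confs E a.out b.out c.out) : ℚ) / Nat.card (b.out ≅ b.out) := by
  have h := card_ext1_mul_card_aut E a.out b.out c.out
  rw [show isoClass b.out = b from Quotient.out_eq b] at h
  have h₀ : hallCoeff E a c b = hallCoeffObj E a.out c.out b := by
    conv_lhs => rw [← Quotient.out_eq a, ← Quotient.out_eq c]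
    rfl
  have h₁ : (Nat.card (b.out ≅ b.out) : ℚ) ≠ 0 := by exact_mod_cast (card_aut_pos _).ne'
  have h₂ : (Nat.card (a.out ⟶ c.out) : ℚ) ≠ 0 := by exact_mod_cast (card_hom_pos _ _).ne'
  rw [h₀, hallCoeffObj, div_eq_div_iff h₂ h₁]
  exact_mod_cast h

/-- A weighted count of the isomorphism classes which complete given data. -/
theorem card_eq_sum_card_div_card_aut {F : Type u} [Category.{v} F]
    [∀ A B : F, Finite (A ⟶ B)] {L : Type v} [Finite L] (s : Finset (IsoClasses F))
    (R : IsoClasses F → Type v) [∀ y, Finite (R y)] (rel : ∀ y, L → R y → Prop)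
    (h : ∀ l, ∃ Y : F, isoClass Y ∈ s ∧
      ∀ y : IsoClasses F, Nonempty ({r : R y // rel y l r} ≃ (Y ≅ y.out))) :
    (Nat.card L : ℚ) = ∑ y ∈ s,
      (Nat.card {x : L × R y // rel y x.1 x.2} : ℚ) / Nat.card (y.out ≅ y.out) := by
  classical
  have := Fintype.ofFinite L
  have h₁ (y) : Nat.card {x : L × R y // rel y x.1 x.2} =
      ∑ l : L, Nat.card {r : R y // rel y l r} := by
    rw [← Nat.card_sigma]
    exact Nat.card_congr (Equiv.subtypeProdEquivSigmaSubtype _)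
  simp only [h₁, Nat.cast_sum, Finset.sum_div]
  rw [Finset.sum_comm, Nat.card_eq_fintype_card, ← Finset.card_univ, Finset.card_eq_sum_ones,
    Nat.cast_sum]
  -- Each `l` contributes exactly `1`: only the class of `Y` admits completions, and it admits `|Aut
  -- Y|` of them.
  refine Finset.sum_congr rfl fun l _ => ?_
  obtain ⟨Y, hY, e⟩ := h l
  rw [Finset.sum_eq_single_of_mem _ hY]
  · obtain ⟨φ⟩ : Nonempty ((isoClass Y).out ≅ Y) := Quotient.exact (Quotient.out_eq (isoClass Y))
    have : Nat.card (Y ≅ (isoClass Y).out) = Nat.card ((isoClass Y).out ≅ (isoClass Y).out) :=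
      Nat.card_congr (φ.symm.isoCongr (Iso.refl _))
    rw [Nat.card_congr (e _).some, this, div_self (by exact_mod_cast (card_aut_pos _).ne'),
      Nat.cast_one]
  · intro y _ hy
    have : IsEmpty (Y ≅ y.out) := ⟨fun φ => hy ((Quotient.out_eq y).symm.trans
      (Quotient.sound ⟨φ.symm⟩))⟩
    rw [Nat.card_congr (e _).some]
    simp

end Counting

/-! ## Associativity of the Hall product -/

section Associativity

variable {F : Type u} [Category.{v} F] [Preadditive F] {E : ExactStructure F}

theorem IsConf.exists_iso_left {A A' B C : F} {i : A ⟶ B} {i' : A' ⟶ B} {p : B ⟶ C}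
    (h : IsConf E i p) (h' : IsConf E i' p) : ∃ φ : A ≅ A', φ.hom ≫ i' = i := by
  have := h.mono
  have := h'.mono
  obtain ⟨a, ha⟩ := h.exists_lift i' h'.zero
  obtain ⟨b, hb⟩ := h'.exists_lift i h.zero
  exact ⟨⟨b, a, by rw [← cancel_mono i]; simp [ha, hb],
    by rw [← cancel_mono i']; simp [ha, hb]⟩, hb⟩

theorem IsConf.exists_iso_right {A B C C' : F} {i : A ⟶ B} {p : B ⟶ C} {p' : B ⟶ C'}
    (h : IsConf E i p) (h' : IsConf E i p') : ∃ φ : C ≅ C', p ≫ φ.hom = p' := by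
  have := h.epi
  have := h'.epi
  obtain ⟨a, ha⟩ := h.exists_desc p' h'.zero
  obtain ⟨b, hb⟩ := h'.exists_desc p h.zero
  exact ⟨⟨a, b, by rw [← cancel_epi p]; simp [reassoc_of% ha, hb],
    by rw [← cancel_epi p']; simp [reassoc_of% hb, ha]⟩, ha⟩

/-- The compatibility of two conflations `C ⟶ B ⟶ A`, `D ⟶ X ⟶ B` with two conflations
`D ⟶ Y ⟶ C`, `Y ⟶ X ⟶ A`: together they form a commutative diagram with rows and columns the four
conflations. -/
def Confs.Compat {A B C D X Y : F} (l : Confs E A B C × Confs E B X D)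
    (r : Confs E C Y D × Confs E A X Y) : Prop :=
  r.1.1.1 ≫ r.2.1.1 = l.2.1.1 ∧ l.2.1.2 ≫ l.1.1.2 = r.2.1.2 ∧
    r.1.1.2 ≫ l.1.1.1 = r.2.1.1 ≫ l.2.1.2

/-- The missing object must be the pull-back of `X ⟶ B` along `C ⟶ B`. A completion with middle
object `Y` amounts to an isomorphism from this pull-back to `Y`. -/
theorem Confs.exists_compat_equiv {A B C D X : F} (l : Confs E A B C × Confs E B X D) :
    ∃ Y₀ : F, ∀ Y : F,
      Nonempty ({r : Confs E C Y D × Confs E A X Y // Confs.Compat l r} ≃ (Y₀ ≅ Y)) := by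
  obtain ⟨⟨⟨i, q⟩, hx⟩, ⟨⟨d, p⟩, hz⟩⟩ := l
  obtain ⟨Y₀, j, d', e, hpb, hd, hde⟩ := hz.exists_pullback i
  dsimp only at *
  have hi := hx.mono
  have hj : Mono j := ⟨fun f g hfg => hpb.hom_ext hfg (by
    rw [← cancel_mono i, Category.assoc, Category.assoc, ← hpb.w, reassoc_of% hfg])⟩
  have hja : IsConf E j (p ≫ q) := by
    refine .of_isDeflation (E.comp_deflation _ _ hz.isDeflation hx.isDeflation) ?_ hj ?_
    · rw [hpb.w_assoc, hx.zero, comp_zero]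
    · intro Z f hf
      obtain ⟨g, hg⟩ := hx.exists_lift (f ≫ p) (by simpa using hf)
      exact ⟨hpb.lift f g hg.symm, hpb.lift_fst _ _ _⟩
  refine ⟨Y₀, fun Y => ⟨(Equiv.ofBijective (fun φ : Y₀ ≅ Y =>
    ⟨(⟨(d' ≫ φ.hom, φ.inv ≫ e), hde.of_iso (Iso.refl _) φ (Iso.refl _) (by simp) (by simp)⟩,
      ⟨(φ.inv ≫ j, p ≫ q), hja.of_iso φ (Iso.refl _) (Iso.refl _) (by simp) (by simp)⟩),
      by simp [hd], rfl, by simp [hpb.w]⟩) ⟨?_, ?_⟩).symm⟩⟩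
  · intro φ φ' h
    have h' : φ.inv = φ'.inv := by
      rw [← cancel_mono j]
      exact congrArg (fun z => z.1.2.1.1) h
    exact Iso.ext_inv h'
  · rintro ⟨⟨⟨⟨d₁, e₁⟩, h₁⟩, ⟨⟨j₁, a₁⟩, h₂⟩⟩, h₃, h₄, h₅⟩
    dsimp only at *
    change d₁ ≫ j₁ = d at h₃
    change p ≫ q = a₁ at h₄
    change e₁ ≫ i = j₁ ≫ p at h₅
    change IsConf E j₁ a₁ at h₂
    obtain ⟨φ, hφ⟩ := hja.exists_iso_left (h₄.symm ▸ h₂)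
    have := h₂.mono
    refine ⟨φ, Subtype.ext (Prod.ext (Subtype.ext (Prod.ext ?_ ?_))
      (Subtype.ext (Prod.ext ?_ h₄)))⟩ <;> dsimp only at *
    · rw [← cancel_mono j₁, Category.assoc, hφ, hd, h₃]
    · rw [← cancel_mono i, Category.assoc, ← hpb.w, h₅, ← hφ, Category.assoc, φ.inv_hom_id_assoc]
    · rw [← hφ, φ.inv_hom_id_assoc]

/-- Dually, the missing object is the push-out of `Y ⟶ X` along `Y ⟶ C`. -/
theorem Confs.exists_equiv_compat {A C D X Y : F} (r : Confs E C Y D × Confs E A X Y) :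
    ∃ B₀ : F, ∀ B : F,
      Nonempty ({l : Confs E A B C × Confs E B X D // Confs.Compat l r} ≃ (B₀ ≅ B)) := by
  obtain ⟨⟨⟨d, e⟩, hx⟩, ⟨⟨j, a⟩, hz⟩⟩ := r
  obtain ⟨B₀, p, i, q, hpo, hq, hiq⟩ := hz.exists_pushout e
  dsimp only at *
  have he := hx.epi
  have hp : Epi p := ⟨fun f g hfg => hpo.hom_ext hfg (by
    rw [← cancel_epi e, ← hpo.w_assoc, ← hpo.w_assoc, hfg])⟩
  have hdp : IsConf E (d ≫ j) p := by
    refine .of_isInflation (E.comp_inflation _ _ hx.isInflation hz.isInflation) ?_ hp ?_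
    · rw [Category.assoc, hpo.w, reassoc_of% hx.zero, zero_comp]
    · intro Z f hf
      obtain ⟨g, hg⟩ := hx.exists_desc (j ≫ f) (by simpa using hf)
      exact ⟨hpo.desc f g hg.symm, hpo.inl_desc _ _ _⟩
  refine ⟨B₀, fun B => ⟨(Equiv.ofBijective (fun φ : B₀ ≅ B =>
    ⟨(⟨(i ≫ φ.hom, φ.inv ≫ q), hiq.of_iso (Iso.refl _) φ (Iso.refl _) (by simp) (by simp)⟩,
      ⟨(d ≫ j, p ≫ φ.hom), hdp.of_iso (Iso.refl _) (Iso.refl _) φ (by simp) (by simp)⟩),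
      rfl, by simp [hq], by simp [hpo.w_assoc]⟩) ⟨?_, ?_⟩).symm⟩⟩
  · intro φ φ' h
    refine Iso.ext ?_
    rw [← cancel_epi p]
    exact congrArg (fun z => z.1.2.1.2) h
  · rintro ⟨⟨⟨⟨i₁, q₁⟩, h₁⟩, ⟨⟨d₁, p₁⟩, h₂⟩⟩, h₃, h₄, h₅⟩
    dsimp only at *
    change d ≫ j = d₁ at h₃
    change p₁ ≫ q₁ = a at h₄
    change e ≫ i₁ = j ≫ p₁ at h₅
    change IsConf E d₁ p₁ at h₂
    obtain ⟨φ, hφ⟩ := hdp.exists_iso_right (h₃.symm ▸ h₂)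
    have := h₂.epi
    refine ⟨φ, Subtype.ext (Prod.ext (Subtype.ext (Prod.ext ?_ ?_))
      (Subtype.ext (Prod.ext h₃ ?_)))⟩ <;> dsimp only at *
    · rw [← cancel_epi e, ← hpo.w_assoc, hφ, h₅]
    · rw [← cancel_epi p₁, h₄, ← hφ, Category.assoc, φ.hom_inv_id_assoc, hq]
    · exact hφ

theorem hallBasisMul_eq_sum (a c : IsoClasses F) {s : Finset (IsoClasses F)}
    (hs : Function.support (hallCoeff E a c) ⊆ s) :
    hallBasisMul E a c = ∑ b ∈ s, Finsupp.single b (hallCoeff E a c b) :=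
  finsum_eq_sum_of_support_subset _ fun b hb => hs fun h => hb (by simp [h])

theorem hallMul_single_single (a c : IsoClasses F) (r s : ℚ) :
    hallMul E (Finsupp.single a r) (Finsupp.single c s) = (r * s) • hallBasisMul E a c := by
  simp [hallMul, mul_smul]

variable [∀ A B : F, Finite (A ⟶ B)]

theorem hallCoeff_ne_zero {a c b : IsoClasses F} (h : Nonempty (Confs E a.out b.out c.out)) :
    hallCoeff E a c b ≠ 0 := by
  rw [hallCoeff_eq]
  exact div_ne_zero (by exact_mod_cast Nat.card_pos.ne') (by exact_mod_cast (card_aut_pos _).ne')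

/-- Up to the common factor `1 / |Aut X|`, both sides count compatible quadruples of conflations,
each weighted by `1 / (|Aut B| |Aut Y|)`. Summing over the completions of one pair of conflations
removes one of the two weights. -/
theorem sum_hallCoeff_mul (a c d x : IsoClasses F) {s t : Finset (IsoClasses F)}
    (hs : Function.support (hallCoeff E a c) ⊆ s) (ht : Function.support (hallCoeff E c d) ⊆ t) :
    ∑ b ∈ s, hallCoeff E a c b * hallCoeff E b d x =
      ∑ y ∈ t, hallCoeff E c d y * hallCoeff E a y x := by
  let L (b : IsoClasses F) : Type v := Confs E a.out b.out c.out × Confs E b.out x.out d.out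
  let R (y : IsoClasses F) : Type v := Confs E c.out y.out d.out × Confs E a.out x.out y.out
  have hL (b : IsoClasses F) : (Nat.card (L b) : ℚ) = ∑ y ∈ t,
      (Nat.card {z : L b × R y // Confs.Compat z.1 z.2} : ℚ) / Nat.card (y.out ≅ y.out) := by
    refine card_eq_sum_card_div_card_aut t R (fun y l r => Confs.Compat l r) fun l => ?_
    obtain ⟨Y, hY⟩ := Confs.exists_compat_equiv l
    refine ⟨Y, ht (hallCoeff_ne_zero ?_), fun y => hY _⟩
    obtain ⟨φ⟩ : Nonempty (Y ≅ (isoClass Y).out) :=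
      Quotient.exact (Quotient.out_eq (isoClass Y)).symm
    exact ⟨((hY _).some.symm φ).1.1⟩
  have hR (y : IsoClasses F) : (Nat.card (R y) : ℚ) = ∑ b ∈ s,
      (Nat.card {z : L b × R y // Confs.Compat z.1 z.2} : ℚ) / Nat.card (b.out ≅ b.out) := by
    refine (card_eq_sum_card_div_card_aut s L (fun b r l => Confs.Compat l r) fun r => ?_).trans
      (Finset.sum_congr rfl fun b _ => ?_)
    · obtain ⟨B, hB⟩ := Confs.exists_equiv_compat r
      refine ⟨B, hs (hallCoeff_ne_zero ?_), fun b => hB _⟩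
      obtain ⟨φ⟩ : Nonempty (B ≅ (isoClass B).out) :=
        Quotient.exact (Quotient.out_eq (isoClass B)).symm
      exact ⟨((hB _).some.symm φ).1.1⟩
    · rw [Nat.card_congr ((Equiv.prodComm (R y) (L b)).subtypeEquiv
        (p := fun z => Confs.Compat z.2 z.1) (q := fun z => Confs.Compat z.1 z.2) fun _ => Iff.rfl)]
  have hL' (b : IsoClasses F) : hallCoeff E a c b * hallCoeff E b d x =
      Nat.card (L b) / (Nat.card (b.out ≅ b.out) * Nat.card (x.out ≅ x.out)) := by
    rw [hallCoeff_eq, hallCoeff_eq, Nat.card_prod, Nat.cast_mul, div_mul_div_comm]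
  have hR' (y : IsoClasses F) : hallCoeff E c d y * hallCoeff E a y x =
      Nat.card (R y) / (Nat.card (y.out ≅ y.out) * Nat.card (x.out ≅ x.out)) := by
    rw [hallCoeff_eq, hallCoeff_eq, Nat.card_prod, Nat.cast_mul, div_mul_div_comm]
  simp only [hL', hR', hL, hR, Finset.sum_div]
  rw [Finset.sum_comm]
  refine Finset.sum_congr rfl fun y _ => Finset.sum_congr rfl fun b _ => ?_
  rw [div_div, div_div]
  congr 1
  ring

variable [HasBinaryBiproducts F]

theorem hallCoeff_support_finite (hE : IsFrobenius E) (a c : IsoClasses F) :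
    (Function.support (hallCoeff E a c)).Finite := by
  induction a, c using Quotient.inductionOn₂ with
  | _ A C =>
    have := finite_ext1 hE A C
    refine (Set.finite_range (Ext1.mid (E := E) (A := A) (C := C))).subset fun b hb => ?_
    by_contra hb'
    refine hb ?_
    have : IsEmpty {ξ : Ext1 E A C // ξ.mid = b} := ⟨fun ξ => hb' ⟨ξ.1, ξ.2⟩⟩
    change hallCoeffObj E A C b = 0
    simp [hallCoeffObj]

theorem hallBasisMul_apply (hE : IsFrobenius E) (a c b : IsoClasses F) :
    hallBasisMul E a c b = hallCoeff E a c b := by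
  classical
  have h := (hallCoeff_support_finite hE a c).coe_toFinset.ge
  rw [hallBasisMul_eq_sum a c h, Finsupp.finsetSum_apply]
  simp +contextual [Finsupp.single_apply, eq_comm]

theorem hallMul_assoc (hE : IsFrobenius E) (x y z : Hall F) :
    hallMul E (hallMul E x y) z = hallMul E x (hallMul E y z) := by
  induction x using Finsupp.induction_linear with
  | zero => simp
  | add x x' hx hx' => simp [hx, hx']
  | single a q =>
    induction y using Finsupp.induction_linear with
    | zero => simp
    | add y y' hy hy' => simp only [map_add, LinearMap.add_apply, hy, hy']
    | single c r =>
      induction z using Finsupp.induction_linear with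
      | zero => simp
      | add z z' hz hz' => simp only [map_add, hz, hz']
      | single d s =>
        have h₁ := (hallCoeff_support_finite hE a c).coe_toFinset.ge
        have h₂ := (hallCoeff_support_finite hE c d).coe_toFinset.ge
        ext x
        have := sum_hallCoeff_mul a c d x h₁ h₂
        simp only [hallMul_single_single, hallBasisMul_eq_sum a c h₁, hallBasisMul_eq_sum c d h₂,
          map_smul, map_sum, LinearMap.smul_apply, LinearMap.sum_apply, Finsupp.smul_apply,
          Finsupp.finsetSum_apply, hallBasisMul_apply hE, smul_eq_mul]
        calc _ = q * r * s * ∑ b ∈ (hallCoeff_support_finite hE a c).toFinset,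
              hallCoeff E a c b * hallCoeff E b d x := by
              simp only [Finset.mul_sum]
              exact Finset.sum_congr rfl fun _ _ => by ring
          _ = _ := by
              rw [this]
              simp only [Finset.mul_sum]
              exact Finset.sum_congr rfl fun _ _ => by ring

end Associativity

end SemiDerived

noncomputable section

namespace SemiDerived

/-! ## The monoid of isomorphism classes -/

section Monoid

open scoped ZeroObject

variable {F : Type u} [Category.{v} F]

theorem isoClass_eq_iff {A B : F} : isoClass A = isoClass B ↔ Nonempty (A ≅ B) := Quotient.eq

instance [HasZeroObject F] : Zero (IsoClasses F) := ⟨isoClass 0⟩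

theorem isoClass_zero [HasZeroObject F] : isoClass (0 : F) = 0 := rfl

variable [Preadditive F] [HasBinaryBiproducts F]

instance : Add (IsoClasses F) :=
  ⟨Quotient.map₂ (fun A B : F => A ⊞ B) fun _ _ ⟨e⟩ _ _ ⟨f⟩ => ⟨biprod.mapIso e f⟩⟩

theorem isoClass_biprod (A B : F) : isoClass (A ⊞ B) = isoClass A + isoClass B := rfl

variable [HasZeroObject F]

/-- Isomorphism classes form a commutative monoid under direct sums. -/
instance : AddCommMonoid (IsoClasses F) where
  add_assoc a b c := Quotient.inductionOn₃ a b c fun A B C =>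
    Quotient.sound ⟨biprod.associator A B C⟩
  add_comm a b := Quotient.inductionOn₂ a b fun A B => Quotient.sound ⟨biprod.braiding A B⟩
  zero_add a := Quotient.inductionOn a fun A => Quotient.sound
    ⟨⟨biprod.snd, biprod.inr, by ext; all_goals simp, by simp⟩⟩
  add_zero a := Quotient.inductionOn a fun A => Quotient.sound
    ⟨⟨biprod.fst, biprod.inl, by ext; all_goals simp, by simp⟩⟩
  nsmul := nsmulRec

end Monoid

/-! ## Cancellation -/

/-- The powers of `a` are eventually periodic. An exponent past the preperiod which is a multiple of
the period gives an idempotent. -/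
theorem exists_isIdempotentElem_pow {R : Type*} [Monoid R] [Finite R] (a : R) :
    ∃ n : ℕ, 0 < n ∧ IsIdempotentElem (a ^ n) := by
  obtain ⟨m, m', hne, h⟩ := Finite.exists_ne_map_eq_of_infinite fun n : ℕ => a ^ n
  wlog hlt : m < m' generalizing m m'
  · exact this m' m hne.symm h.symm (by lia)
  obtain ⟨k, rfl⟩ := Nat.exists_eq_add_of_lt hlt
  have key (t j : ℕ) : a ^ (m + j + t * (k + 1)) = a ^ (m + j) := by
    induction t with
    | zero => simp
    | succ t ih =>
      rw [← ih, show m + j + (t + 1) * (k + 1) = m + k + 1 + (j + t * (k + 1)) by ring, pow_add,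
        ← h, ← pow_add]
      congr 1
      ring
  -- The powers have period `k + 1` from `m` on; this exponent is a multiple of the period and at
  -- least `m`.
  refine ⟨(m + 1) * (k + 1), by positivity, ?_⟩
  have := key (m + 1) (m * k + k + 1)
  rw [IsIdempotentElem, ← pow_add]
  convert this using 2 <;> ring

theorem isUnit_or_isNilpotent_of_forall_isIdempotentElem {R : Type*} [Ring R] [Finite R]
    (h : ∀ e : R, IsIdempotentElem e → e = 0 ∨ e = 1) (a : R) : IsUnit a ∨ IsNilpotent a := by
  obtain ⟨n, hn, he⟩ := exists_isIdempotentElem_pow a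
  rcases h _ he with h | h
  · exact .inr ⟨n, h⟩
  · exact .inl ((isUnit_pow_iff hn.ne').1 (h ▸ isUnit_one))

/-- A stable range condition: it allows an elementary operation to turn the entry `a` of an
invertible matrix into a unit. -/
theorem exists_isUnit_add_mul {R : Type*} [Ring R] [Finite R]
    (h : ∀ e : R, IsIdempotentElem e → e = 0 ∨ e = 1) {a b d : R} (hab : b * a + d = 1) :
    ∃ r : R, IsUnit (a + r * d) := by
  obtain ha | ⟨n, hn⟩ := isUnit_or_isNilpotent_of_forall_isIdempotentElem h a
  · exact ⟨0, by simpa using ha⟩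
  obtain hba | hba := isUnit_or_isNilpotent_of_forall_isIdempotentElem h (b * a)
  · obtain ⟨c, hc⟩ := hba.exists_left_inv
    -- If `b * a` were a unit, then `a` would be both nilpotent and left invertible, so the ring
    -- would be trivial.
    have h₁ (m : ℕ) : (c * b) ^ m * a ^ m = 1 := by
      induction m with
      | zero => simp
      | succ m ih => rw [pow_succ, pow_succ', mul_assoc, ← mul_assoc _ a, mul_assoc c b a, hc,
          one_mul, ih]
    have : (1 : R) = 0 := by rw [← h₁ n, hn, mul_zero]
    have := subsingleton_of_zero_eq_one this.symm
    exact ⟨0, isUnit_of_subsingleton _⟩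
  · obtain ⟨u, rfl⟩ : IsUnit d := by
      rw [← eq_sub_iff_add_eq'] at hab
      exact hab ▸ hba.isUnit_one_sub
    -- With this choice `a + r * d = 1`.
    exact ⟨(1 - a) * ↑u⁻¹, by simp [mul_assoc]⟩

section Cancellation

variable {F : Type u} [Category.{v} F] [Preadditive F] [HasBinaryBiproducts F]
  [∀ A B : F, Finite (A ⟶ B)]

/-- After an elementary operation the `M`-to-`M` entry of the isomorphism is invertible, and
Gaussian elimination then gives `P ≅ Q`. -/
theorem nonempty_iso_of_biprod_of_forall_isIdempotentElem {M P Q : F}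
    (h : ∀ e : M ⟶ M, e ≫ e = e → e = 0 ∨ e = 𝟙 M) (f : M ⊞ P ≅ M ⊞ Q) : Nonempty (P ≅ Q) := by
  let a : End M := biprod.inl ≫ f.hom ≫ biprod.fst
  let b : End M := biprod.inl ≫ f.inv ≫ biprod.fst
  let c : M ⟶ Q := biprod.inl ≫ f.hom ≫ biprod.snd
  let d : Q ⟶ M := biprod.inr ≫ f.inv ≫ biprod.fst
  let g : End M := c ≫ d
  have : Finite (End M) := inferInstanceAs (Finite (M ⟶ M))
  -- The `M`-to-`M` entry of `f.hom ≫ f.inv = 𝟙`; products in `End M` are compositions in the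
  -- reverse order.
  have hab : b * a + g = 1 := by
    have : biprod.inl ≫ f.hom ≫ (biprod.fst ≫ biprod.inl + biprod.snd ≫ biprod.inr) ≫ f.inv ≫
      biprod.fst = 𝟙 M := by simp
    simp only [Preadditive.add_comp, Preadditive.comp_add] at this
    simpa [a, b, c, d, g, End.mul_def, End.one_def] using this
  obtain ⟨r, hr⟩ := exists_isUnit_add_mul (R := End M) (fun e he => h e he) hab
  have : IsIso (biprod.inl ≫ (f ≪≫ Biprod.unipotentLower (d ≫ r)).hom ≫ biprod.fst) := by
    have h₁ : biprod.inl ≫ (f ≪≫ Biprod.unipotentLower (d ≫ r)).hom ≫ biprod.fst =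
        biprod.inl ≫ f.hom ≫ biprod.fst + c ≫ d ≫ r := by
      simp [Biprod.unipotentLower, Biprod.ofComponents, c]
    rw [h₁]
    simpa [End.mul_def, g] using (isUnit_iff_isIso _).1 hr
  exact ⟨Biprod.isoElim (f ≪≫ Biprod.unipotentLower (d ≫ r))⟩

variable [IsIdempotentComplete F]

theorem exists_iso_biprod_of_idempotent {M : F} {e : M ⟶ M} (he : e ≫ e = e) (h₀ : e ≠ 0)
    (h₁ : e ≠ 𝟙 M) : ∃ M₁ M₂ : F, Nonempty (M ≅ M₁ ⊞ M₂) ∧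
      Nat.card (M₁ ⟶ M₁) < Nat.card (M ⟶ M) ∧ Nat.card (M₂ ⟶ M₂) < Nat.card (M ⟶ M) := by
  have card_lt {e : M ⟶ M} (h₁ : e ≠ 𝟙 M) {N : F} {i : N ⟶ M} {p : M ⟶ N} (hip : i ≫ p = 𝟙 N)
      (hpi : p ≫ i = e) : Nat.card (N ⟶ N) < Nat.card (M ⟶ M) := by
    have := Fintype.ofFinite (N ⟶ N)
    have := Fintype.ofFinite (M ⟶ M)
    rw [Nat.card_eq_fintype_card, Nat.card_eq_fintype_card]
    -- `End N` is identified with the corner `e End(M) e`, which misses `𝟙 M` because `e ≠ 𝟙 M`.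
    refine Fintype.card_lt_of_injective_not_surjective (fun f : N ⟶ N => p ≫ f ≫ i)
      (fun f g hfg => ?_) fun hs => ?_
    · have := congrArg (fun x => i ≫ x ≫ p) hfg
      simpa [hip, reassoc_of% hip] using this
    · obtain ⟨f, hf⟩ := hs (𝟙 M)
      refine h₁ ?_
      have := congrArg (fun x => e ≫ x) hf
      simp only [← hpi, Category.assoc, reassoc_of% hip] at this
      rw [← hpi, ← Category.comp_id (p ≫ i), Category.assoc, ← this, ← hf]
  obtain ⟨M₁, i₁, p₁, hip₁, hpi₁⟩ := IsIdempotentComplete.idempotents_split M e he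
  obtain ⟨M₂, i₂, p₂, hip₂, hpi₂⟩ := IsIdempotentComplete.idempotents_split M (𝟙 M - e)
    (by simp [he])
  have h₁₂ : i₁ ≫ p₂ = 0 := by
    have : i₁ ≫ (p₁ ≫ i₁) ≫ (p₂ ≫ i₂) ≫ p₂ = 0 := by
      rw [hpi₁, hpi₂, ← Category.assoc e]; simp [he]
    simpa [hip₁, hip₂, reassoc_of% hip₁] using this
  have h₂₁ : i₂ ≫ p₁ = 0 := by
    have : i₂ ≫ (p₂ ≫ i₂) ≫ (p₁ ≫ i₁) ≫ p₁ = 0 := by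
      rw [hpi₁, hpi₂, ← Category.assoc (_ - _)]; simp [he]
    simpa [hip₁, hip₂, reassoc_of% hip₂] using this
  refine ⟨M₁, M₂, ⟨⟨biprod.lift p₁ p₂, biprod.desc i₁ i₂, by simp [hpi₁, hpi₂], ?_⟩⟩,
    card_lt h₁ hip₁ hpi₁, card_lt ?_ hip₂ hpi₂⟩
  · ext <;> simp [hip₁, hip₂, h₁₂, h₂₁]
  · simpa using h₀

variable [HasZeroObject F]

/-- Induction on `|End M|`: an object with only trivial idempotents is cancelled directly, and any
other splits into two summands with smaller endomorphism rings. -/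
theorem isoClass_add_left_cancel (M : F) {a b : IsoClasses F}
    (h : isoClass M + a = isoClass M + b) : a = b := by
  by_cases hM : ∀ e : M ⟶ M, e ≫ e = e → e = 0 ∨ e = 𝟙 M
  · induction a, b using Quotient.inductionOn₂ with
    | _ P Q =>
      obtain ⟨f⟩ := isoClass_eq_iff.1 h
      exact isoClass_eq_iff.2 (nonempty_iso_of_biprod_of_forall_isIdempotentElem hM f)
  · push Not at hM
    obtain ⟨e, he, h₀, h₁⟩ := hM
    obtain ⟨M₁, M₂, ⟨φ⟩, hlt₁, hlt₂⟩ := exists_iso_biprod_of_idempotent he h₀ h₁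
    rw [isoClass_eq_iff.2 ⟨φ⟩, isoClass_biprod, add_assoc, add_assoc] at h
    exact isoClass_add_left_cancel M₂ (isoClass_add_left_cancel M₁ h)
termination_by Nat.card (M ⟶ M)

instance : IsCancelAdd (IsoClasses F) :=
  have : IsLeftCancelAdd (IsoClasses F) :=
    ⟨fun m => Quotient.inductionOn m fun M _ _ h => isoClass_add_left_cancel M h⟩
  AddCommMagma.IsLeftCancelAdd.toIsCancelAdd _

end Cancellation

/-! ## Stable isomorphism -/

section Stable

variable {F : Type u} [Category.{v} F] [Preadditive F] {E : ExactStructure F}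

/-- A projective object of a Frobenius category is projective-injective. -/
def IsProjective.toProjInj (hE : IsFrobenius E) {P : F} (hP : IsProjective E P) : ProjInj E :=
  ⟨P, hP, (hE.projective_iff_injective P).1 hP⟩

variable [HasBinaryBiproducts F]

theorem congruence_stableRel [HasZeroObject F] (hE : IsFrobenius E) :
    Congruence (stableRel E) where
  comp_left f g g' h := by
    obtain ⟨P, x, y, h⟩ := h
    exact ⟨P, f ≫ x, y, by rw [← Preadditive.comp_sub, h, Category.assoc]⟩
  comp_right g h := by
    obtain ⟨P, x, y, h⟩ := h
    exact ⟨P, x, y ≫ g, by rw [← Preadditive.sub_comp, h, Category.assoc]⟩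
  equivalence :=
    { refl := fun f => ⟨(isProjective_of_isZero (isZero_zero F)).toProjInj hE, 0, 0, by simp⟩
      symm := by
        rintro f g ⟨P, x, y, h⟩
        exact ⟨P, -x, y, by rw [Preadditive.neg_comp, ← h, neg_sub]⟩
      trans := by
        rintro f g h ⟨P, x, y, h₁⟩ ⟨Q, z, w, h₂⟩
        exact ⟨(P.2.1.biprod Q.2.1).toProjInj hE, biprod.lift x z, biprod.desc y w,
          (sub_add_sub_cancel f g h).symm.trans (by rw [h₁, h₂]; exact biprod.lift_desc.symm)⟩ }

theorem stableClass_eq_of_iso {F : Type u} [Category.{v} F] [Preadditive F]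
    {E : ExactStructure F} {M N : F} (φ : M ≅ N) : stableClass E M = stableClass E N :=
  isoClass_eq_iff.2 ⟨(CategoryTheory.Quotient.functor (stableRel E)).mapIso φ⟩

theorem stableClass_biprod (M : F) {P : F} (hP : IsProjective E P ∧ IsInjective E P) :
    stableClass E (M ⊞ P) = stableClass E M := by
  refine isoClass_eq_iff.2
    ⟨⟨(CategoryTheory.Quotient.functor (stableRel E)).map biprod.fst,
      (CategoryTheory.Quotient.functor (stableRel E)).map biprod.inl, ?_, ?_⟩⟩
  · rw [← CategoryTheory.Functor.map_comp, ← CategoryTheory.Functor.map_id]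
    refine CategoryTheory.Quotient.sound _ ⟨⟨P, hP⟩, -biprod.snd, biprod.inr, ?_⟩
    rw [← biprod.total, Preadditive.neg_comp]
    abel
  · rw [← CategoryTheory.Functor.map_comp, biprod.inl_fst, CategoryTheory.Functor.map_id]

variable [HasZeroObject F] [IsIdempotentComplete F]

/-- Two objects are isomorphic in the stable category if and only if they are isomorphic up to
projective-injective direct summands. -/
theorem stableClass_eq_iff (hE : IsFrobenius E) {M N : F} :
    stableClass E M = stableClass E N ↔
      ∃ P Q : ProjInj E, isoClass M + isoClass P.1 = isoClass N + isoClass Q.1 := by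
  constructor
  · intro h
    have := congruence_stableRel hE
    obtain ⟨φ⟩ := isoClass_eq_iff.1 h
    obtain ⟨f, hf⟩ := (CategoryTheory.Quotient.functor (stableRel E)).map_surjective φ.hom
    obtain ⟨g, hg⟩ := (CategoryTheory.Quotient.functor (stableRel E)).map_surjective φ.inv
    obtain ⟨P, x, y, hxy⟩ : stableRel E (f ≫ g) (𝟙 M) := by
      rw [← CategoryTheory.Quotient.functor_map_eq_iff (stableRel E),
        CategoryTheory.Functor.map_comp, CategoryTheory.Functor.map_id, hf, hg,
        φ.hom_inv_id]
    obtain ⟨P', x', y', hxy'⟩ : stableRel E (g ≫ f) (𝟙 N) := by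
      rw [← CategoryTheory.Quotient.functor_map_eq_iff (stableRel E),
        CategoryTheory.Functor.map_comp, CategoryTheory.Functor.map_id, hf, hg,
        φ.inv_hom_id]
    -- A stable isomorphism `f` with stable inverse `g` becomes a genuine split monomorphism after
    -- adding an injective `I` containing `M`. The error `x ≫ y` of `f ≫ g` extends along `j` and is
    -- cancelled by the second component of `r`.
    obtain ⟨I, C₀, j, p, w, hc, hI⟩ := hE.enough_injectives M
    have hI' := (hE.projective_iff_injective I).2 hI
    obtain ⟨z, hz⟩ := P.2.2.exists_desc (i := j) (p := p) ⟨w, hc⟩ x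
    have hmr : biprod.lift f j ≫ biprod.desc g (-(z ≫ y)) = 𝟙 M := by
      simp [reassoc_of% hz, ← hxy]
    set m := biprod.lift f j with hm
    set r := biprod.desc g (-(z ≫ y))
    obtain ⟨C, s, t, hst, hts⟩ := IsIdempotentComplete.idempotents_split (N ⊞ I) (𝟙 _ - r ≫ m)
      (by simp [reassoc_of% hmr])
    have hmt : m ≫ t = 0 := by
      have : m ≫ (t ≫ s) ≫ t = 0 := by simp [hts, reassoc_of% hmr]
      simpa [hst] using this
    have hsr : s ≫ r = 0 := by
      have : s ≫ (t ≫ s) ≫ r = 0 := by simp [hts, hmr]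
      simpa [reassoc_of% hst] using this
    let φ : N ⊞ I ≅ M ⊞ C := ⟨biprod.lift r t, biprod.desc m s, by simp [hts], by
      ext <;> simp [hmr, hmt, hsr, hst]⟩
    -- The relations `m ≫ t = 0` and `g ≫ f = 𝟙 + x' ≫ y'` show that the restriction of `t` to `N`
    -- factors through `I ⊞ P'`. Hence so does `𝟙 C = s ≫ t`, and the complement `C` is a retract of
    -- a projective.
    have ht : biprod.inl ≫ t = -(g ≫ j ≫ biprod.inr ≫ t) - x' ≫ y' ≫ biprod.inl ≫ t := by
      have h₁ : g ≫ f ≫ biprod.inl ≫ t + g ≫ j ≫ biprod.inr ≫ t = 0 := by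
        have : m = f ≫ biprod.inl + j ≫ biprod.inr := by ext <;> simp [hm]
        rw [this, Preadditive.add_comp] at hmt
        simpa using congrArg (g ≫ ·) hmt
      have h₂ := congrArg (· ≫ biprod.inl ≫ t) hxy'
      simp only [Preadditive.sub_comp, Category.assoc, Category.id_comp] at h₂
      rw [← h₂, ← eq_neg_of_add_eq_zero_left h₁]
      abel
    have hC : IsProjective E C := by
      refine (hI'.biprod P'.2.1).of_retract
        (biprod.lift (s ≫ biprod.snd - s ≫ biprod.fst ≫ g ≫ j) (-(s ≫ biprod.fst ≫ x')))
        (biprod.desc (biprod.inr ≫ t) (y' ≫ biprod.inl ≫ t)) ?_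
      have h₁ : s ≫ (biprod.fst ≫ biprod.inl + biprod.snd ≫ biprod.inr) ≫ t = 𝟙 C := by
        rw [biprod.total, Category.id_comp, hst]
      rw [Preadditive.add_comp, Preadditive.comp_add, Category.assoc, Category.assoc, ht] at h₁
      rw [biprod.lift_desc, ← h₁]
      simp only [Preadditive.sub_comp, Preadditive.neg_comp, Category.assoc,
        Preadditive.comp_sub, Preadditive.comp_neg]
      abel
    exact ⟨hC.toProjInj hE, hI'.toProjInj hE, (isoClass_eq_iff.2 ⟨φ⟩).symm⟩
  · rintro ⟨P, Q, h⟩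
    obtain ⟨φ⟩ := isoClass_eq_iff.1 h
    rw [← stableClass_biprod M P.2, ← stableClass_biprod N Q.2]
    exact stableClass_eq_of_iso φ

end Stable

end SemiDerived

end

noncomputable section

namespace SemiDerived

/-! ### The Hall algebra as a ring, and the Ore condition for projective-injectives. -/

section HallAlgebra

variable {F : Type u} [Category.{v} F] [Preadditive F] {E : ExactStructure F}

/-- The Hall algebra of a Frobenius category, with its ring structure. -/
def HallAlgebra {F : Type u} [Category.{v} F] [Preadditive F] {E : ExactStructure F}
    (_ : IsFrobenius E) : Type u := IsoClasses F →₀ ℚ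

namespace HallAlgebra

variable (hE : IsFrobenius E)

instance : AddCommGroup (HallAlgebra hE) := inferInstanceAs (AddCommGroup (IsoClasses F →₀ ℚ))

instance : Module ℚ (HallAlgebra hE) := inferInstanceAs (Module ℚ (IsoClasses F →₀ ℚ))

/-- The basis element attached to an isomorphism class. -/
def of (a : IsoClasses F) : HallAlgebra hE := Finsupp.single a (1 : ℚ)

theorem linearIndependent_of : LinearIndependent ℚ (of hE) :=
  Finsupp.linearIndependent_single_one ℚ _

theorem induction {hE : IsFrobenius E} {p : HallAlgebra hE → Prop} (x : HallAlgebra hE) (zero : p 0)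
    (add : ∀ x y, p x → p y → p (x + y)) (smul_of : ∀ (c : ℚ) a, p (c • of hE a)) : p x := by
  refine Finsupp.induction_linear (M := ℚ) x zero add fun a c => ?_
  have : Finsupp.single a c = c • Finsupp.single a (1 : ℚ) := by simp
  rw [this]
  exact smul_of c a

/-- The coordinate of an element at an isomorphism class. -/
def coord (a : IsoClasses F) : HallAlgebra hE →ₗ[ℚ] ℚ := Finsupp.lapply a

theorem coord_of_self (a : IsoClasses F) : coord hE a (of hE a) = 1 := Finsupp.single_eq_same

theorem coord_of_ne {a b : IsoClasses F} (h : a ≠ b) : coord hE a (of hE b) = 0 :=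
  Finsupp.single_eq_of_ne h

theorem eq_zero_of_coord {hE : IsFrobenius E} {x : HallAlgebra hE} (h : ∀ a, coord hE a x = 0) :
    x = 0 :=
  Finsupp.ext h

end HallAlgebra

variable [HasBinaryBiproducts F] [∀ A B : F, Finite (A ⟶ B)]

theorem homCard_eq_one {F : Type u} [Category.{v} F] [Preadditive F]
    [∀ A B : F, Finite (A ⟶ B)] {A C : F} (h : Subsingleton (A ⟶ C)) : homCard A C = 1 :=
  Units.ext <| by
    have : Nonempty (A ⟶ C) := ⟨0⟩
    simp [homCard]

/-- Only the split extension contributes, so the product is a single term with coefficient `1 /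
|Hom(A, C)|`. -/
theorem hallBasisMul_of_subsingleton {A C : F} (h : Subsingleton (Ext1 E A C)) :
    hallBasisMul E (isoClass A) (isoClass C) =
      Finsupp.single (isoClass A + isoClass C) (((homCard A C)⁻¹ : ℚˣ) : ℚ) := by
  have hmid (ξ : Ext1 E A C) : ξ.mid = isoClass A + isoClass C := by
    rw [h.elim ξ (isConf_biprod C A).cls]
    exact Quotient.sound ⟨biprod.braiding C A⟩
  have h₁ : hallCoeff E (isoClass A) (isoClass C) (isoClass A + isoClass C) =
      (((homCard A C)⁻¹ : ℚˣ) : ℚ) := by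
    change hallCoeffObj E A C _ = _
    have : Nat.card {ξ : Ext1 E A C // ξ.mid = isoClass A + isoClass C} = 1 :=
      Nat.card_eq_one_iff_unique.2 ⟨inferInstance, ⟨(isConf_biprod C A).cls, hmid _⟩⟩
    rw [hallCoeffObj, this, Units.val_inv_eq_inv_val, homCard, Units.val_mk0, Nat.cast_one, one_div]
  rw [hallBasisMul_eq_sum (s := {isoClass A + isoClass C}), Finset.sum_singleton, h₁]
  intro b hb
  by_contra hne
  refine hb ?_
  change hallCoeffObj E A C b = 0
  have : IsEmpty {ξ : Ext1 E A C // ξ.mid = b} := ⟨fun ξ => hne (by simp [← ξ.2, hmid])⟩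
  simp [hallCoeffObj]

variable [HasZeroObject F]

open scoped ZeroObject

namespace HallAlgebra

variable (hE : IsFrobenius E)

theorem hallMul_one_left (x : Hall F) :
    hallMul E (Finsupp.single 0 1) x = x := by
  induction x using Finsupp.induction_linear with
  | zero => simp
  | add x y hx hy => rw [map_add, hx, hy]
  | single a r =>
    induction a using Quotient.inductionOn with
    | _ A =>
      rw [hallMul_single_single, ← isoClass_zero, hallBasisMul_of_subsingleton
        (isProjective_of_isZero (isZero_zero F) A), isoClass_zero, zero_add,
        homCard_eq_one ⟨(isZero_zero F).eq_of_src⟩]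
      simp

theorem hallMul_one_right (hE : IsFrobenius E) (x : Hall F) :
    hallMul E x (Finsupp.single 0 1) = x := by
  induction x using Finsupp.induction_linear with
  | zero => simp
  | add x y hx hy => rw [map_add, LinearMap.add_apply, hx, hy]
  | single a r =>
    induction a using Quotient.inductionOn with
    | _ A =>
      rw [hallMul_single_single, ← isoClass_zero, hallBasisMul_of_subsingleton
        ((hE.projective_iff_injective 0).1 (isProjective_of_isZero (isZero_zero F)) A),
        isoClass_zero, add_zero,
        homCard_eq_one ⟨(isZero_zero F).eq_of_tgt⟩]
      simp

instance : Ring (HallAlgebra hE) where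
  __ := (inferInstance : AddCommGroup (HallAlgebra hE))
  mul x y := hallMul E x y
  one := of hE 0
  mul_assoc := hallMul_assoc hE
  one_mul := hallMul_one_left
  mul_one := hallMul_one_right hE
  zero_mul := LinearMap.map_zero₂ (hallMul E)
  mul_zero x := LinearMap.map_zero (hallMul E x)
  left_distrib x y z := LinearMap.map_add (hallMul E x) y z
  right_distrib := LinearMap.map_add₂ (hallMul E)

instance : Algebra ℚ (HallAlgebra hE) :=
  Algebra.ofModule (LinearMap.map_smul₂ (hallMul E)) fun c x y => (hallMul E x).map_smul c y

theorem of_mul_of_left (P : ProjInj E) (A : F) :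
    of hE (isoClass P.1) * of hE (isoClass A) =
      (((homCard P.1 A)⁻¹ : ℚˣ) : ℚ) • of hE (isoClass P.1 + isoClass A) := by
  refine (hallMul_single_single _ _ _ _).trans ?_
  rw [one_mul, one_smul, hallBasisMul_of_subsingleton (P.2.1 A)]
  exact (Finsupp.smul_single_one _ _).symm

theorem of_mul_of_right (A : F) (P : ProjInj E) :
    of hE (isoClass A) * of hE (isoClass P.1) =
      (((homCard A P.1)⁻¹ : ℚˣ) : ℚ) • of hE (isoClass A + isoClass P.1) := by
  refine (hallMul_single_single _ _ _ _).trans ?_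
  rw [one_mul, one_smul, hallBasisMul_of_subsingleton (P.2.2 A)]
  exact (Finsupp.smul_single_one _ _).symm

/-- Classes of projective-injective objects commute up to scalars with basis elements. -/
theorem exists_of_mul_of_eq (P : ProjInj E) (A : F) : ∃ c : ℚˣ,
    of hE (isoClass P.1) * of hE (isoClass A) =
      (c : ℚ) • (of hE (isoClass A) * of hE (isoClass P.1)) :=
  ⟨(homCard P.1 A)⁻¹ * homCard A P.1, by
    rw [of_mul_of_left, of_mul_of_right, smul_smul, ← Units.val_mul, mul_assoc, mul_inv_cancel,
      mul_one, add_comm]⟩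

/-- The submonoid of scalar multiples of classes of projective-injective objects. -/
def projSubmonoid : Submonoid (HallAlgebra hE) where
  -- Scalars are needed for closure: `[P] [Q]` is only a multiple of `[P ⊕ Q]`.
  carrier := {x | ∃ (c : ℚˣ) (P : ProjInj E), x = (c : ℚ) • of hE (isoClass P.1)}
  one_mem' := ⟨1, (isProjective_of_isZero (isZero_zero F)).toProjInj hE, (one_smul ℚ _).symm⟩
  mul_mem' := by
    rintro _ _ ⟨c, P, rfl⟩ ⟨d, Q, rfl⟩
    refine ⟨c * d * (homCard P.1 Q.1)⁻¹, (P.2.1.biprod Q.2.1).toProjInj hE, ?_⟩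
    rw [smul_mul_smul_comm, of_mul_of_left, smul_smul]
    simp only [Units.val_mul]
    rfl

theorem of_mem_projSubmonoid (P : ProjInj E) : of hE (isoClass P.1) ∈ projSubmonoid hE :=
  ⟨1, P, (one_smul ℚ _).symm⟩

theorem exists_of_mul_eq (P : ProjInj E) (x : HallAlgebra hE) :
    ∃ y, of hE (isoClass P.1) * x = y * of hE (isoClass P.1) := by
  induction x using induction with
  | zero => exact ⟨0, by simp⟩
  | add x x' hx hx' =>
    obtain ⟨y, hy⟩ := hx
    obtain ⟨y', hy'⟩ := hx'
    exact ⟨y + y', by rw [mul_add, add_mul, hy, hy']⟩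
  | smul_of c a =>
    induction a using Quotient.inductionOn with
    | _ A =>
      obtain ⟨d, hd⟩ := exists_of_mul_of_eq hE P A
      exact ⟨c • (d : ℚ) • of hE (isoClass A), by
        rw [mul_smul_comm, hd, smul_mul_assoc, smul_mul_assoc]⟩

variable [IsIdempotentComplete F]

/-- A linear map which translates the basis elements up to nonzero scalars is injective. -/
theorem eq_zero_of_translation (p : IsoClasses F) (L : HallAlgebra hE →ₗ[ℚ] HallAlgebra hE)
    (hL : ∀ A : F, ∃ c : ℚˣ, L (of hE (isoClass A)) = (c : ℚ) • of hE (p + isoClass A))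
    {x : HallAlgebra hE} (hx : L x = 0) : x = 0 := by
  replace hL (a : IsoClasses F) : ∃ c : ℚˣ, L (of hE a) = (c : ℚ) • of hE (p + a) :=
    Quotient.inductionOn a hL
  choose c hc using hL
  have key (a : IsoClasses F) (x : HallAlgebra hE) :
      coord hE (p + a) (L x) = c a * coord hE a x := by
    induction x using induction with
    | zero => simp
    | add x y hx hy => rw [map_add, map_add, map_add, hx, hy, mul_add]
    | smul_of d b =>
      rw [map_smul, map_smul, map_smul, hc, map_smul]
      by_cases h : a = b
      · rw [h, coord_of_self, coord_of_self]
        simp [mul_comm]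
      -- Cancellation in the monoid of isomorphism classes is used here: translation by `p` keeps
      -- distinct classes distinct.
      · rw [coord_of_ne _ h, coord_of_ne _ fun h' => h (add_left_cancel h')]
        simp
  refine eq_zero_of_coord fun a => ?_
  have := key a x
  rw [hx, map_zero, eq_comm, mul_eq_zero] at this
  exact this.resolve_left (c a).ne_zero

theorem eq_zero_of_of_mul_eq_zero (P : ProjInj E) {x : HallAlgebra hE}
    (h : of hE (isoClass P.1) * x = 0) : x = 0 :=
  eq_zero_of_translation hE (isoClass P.1) (LinearMap.mulLeft ℚ (of hE (isoClass P.1)))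
    (fun A => ⟨_, of_mul_of_left hE P A⟩) h

theorem eq_zero_of_mul_of_eq_zero (P : ProjInj E) {x : HallAlgebra hE}
    (h : x * of hE (isoClass P.1) = 0) : x = 0 :=
  eq_zero_of_translation hE (isoClass P.1) (LinearMap.mulRight ℚ (of hE (isoClass P.1)))
    (fun A => ⟨_, (of_mul_of_right hE A P).trans (by rw [add_comm])⟩) h

theorem projSubmonoid_le_nonZeroDivisorsLeft :
    projSubmonoid hE ≤ nonZeroDivisorsLeft (HallAlgebra hE) := by
  rintro _ ⟨c, P, rfl⟩ x hx
  rw [smul_mul_assoc, smul_eq_zero] at hx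
  exact eq_zero_of_of_mul_eq_zero hE P (hx.resolve_left c.ne_zero)

/-- Reversibility holds because right multiplication by `[P]` is injective. The Ore condition holds
because `[P]` commutes with basis elements up to scalars, so the same denominator serves on the
other side. -/
theorem nonempty_oreSet : Nonempty (OreLocalization.OreSet (projSubmonoid hE)) := by
  refine OreLocalization.nonempty_oreSet_iff.2 ⟨?_, ?_⟩
  · rintro x y ⟨_, c, P, rfl⟩ h
    rw [← sub_eq_zero, ← sub_mul, mul_smul_comm, smul_eq_zero] at h
    rw [sub_eq_zero.1 (eq_zero_of_mul_of_eq_zero hE P (h.resolve_left c.ne_zero))]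
    exact ⟨1, rfl⟩
  · rintro x ⟨_, c, P, rfl⟩
    obtain ⟨y, hy⟩ := exists_of_mul_eq hE P x
    exact ⟨y, ⟨_, c, P, rfl⟩, by rw [smul_mul_assoc, mul_smul_comm, hy]⟩

instance : OreLocalization.OreSet (projSubmonoid hE) := (nonempty_oreSet hE).some

end HallAlgebra

end HallAlgebra

end SemiDerived

end

noncomputable section

namespace SemiDerived

/-! ## The Hall algebra inside the semi-derived Hall algebra -/

section SDH

open scoped ZeroObject

variable {F : Type u} [Category.{v} F] [Preadditive F] [HasZeroObject F] {E : ExactStructure F}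

namespace SDH

/-- The formal inverse of the class of a projective-injective object. -/
def invCls (P : ProjInj E) : SDH E :=
  RingQuot.mkAlgHom ℚ (SDHRel E) (FreeAlgebra.ι ℚ (Sum.inr P))

theorem cls_mul_invCls (P : ProjInj E) : cls E P.1 * invCls P = 1 :=
  (map_mul (RingQuot.mkAlgHom ℚ (SDHRel E)) _ _).symm.trans <|
    (RingQuot.mkAlgHom_rel ℚ (SDHRel.mul_inv P)).trans (map_one _)

theorem invCls_mul_cls (P : ProjInj E) : invCls P * cls E P.1 = 1 :=
  (map_mul (RingQuot.mkAlgHom ℚ (SDHRel E)) _ _).symm.trans <|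
    (RingQuot.mkAlgHom_rel ℚ (SDHRel.inv_mul P)).trans (map_one _)

/-- The class of a projective-injective object, as a unit. -/
def unitCls (P : ProjInj E) : (SDH E)ˣ :=
  ⟨cls E P.1, invCls P, cls_mul_invCls P, invCls_mul_cls P⟩

theorem induction {p : SDH E → Prop} (x : SDH E) (algebraMap : ∀ c : ℚ, p (algebraMap ℚ _ c))
    (add : ∀ x y, p x → p y → p (x + y)) (mul : ∀ x y, p x → p y → p (x * y))
    (cls : ∀ A : F, p (cls E A)) (invCls : ∀ P : ProjInj E, p (invCls P)) : p x := by
  obtain ⟨x, rfl⟩ := RingQuot.mkAlgHom_surjective ℚ (SDHRel E) x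
  induction x using FreeAlgebra.induction with
  | grade0 r =>
    rw [AlgHom.commutes]
    exact algebraMap r
  | grade1 x =>
    obtain a | P := x
    · induction a using Quotient.inductionOn with
      | _ A =>
        have := cls A
        rwa [SDH.cls, hallSymbol, Finsupp.linearCombination_single, one_smul] at this
    · exact invCls P
  | mul x y hx hy => rw [map_mul]; exact mul _ _ hx hy
  | add x y hx hy => rw [map_add]; exact add _ _ hx hy

variable [HasBinaryBiproducts F] [∀ A B : F, Finite (A ⟶ B)] (hE : IsFrobenius E)

/-- The localization homomorphism. -/
def ofHall : HallAlgebra hE →ₐ[ℚ] SDH E :=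
  AlgHom.ofLinearMap ((RingQuot.mkAlgHom ℚ (SDHRel E)).toLinearMap ∘ₗ hallSymbol E)
    ((RingQuot.mkAlgHom_rel ℚ SDHRel.one).trans (map_one _))
    fun x y => (RingQuot.mkAlgHom_rel ℚ (SDHRel.mul x y)).symm.trans (map_mul _ _ _)

theorem ofHall_of (A : F) : ofHall hE (.of hE (isoClass A)) = cls E A := rfl

/-- The universal property of the localization. -/
theorem exists_algHom {A : Type*} [Ring A] [Algebra ℚ A] (f : HallAlgebra hE →ₐ[ℚ] A)
    (hf : ∀ P : ProjInj E, IsUnit (f (.of hE (isoClass P.1)))) :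
    ∃ ψ : SDH E →ₐ[ℚ] A, ∀ x, ψ (ofHall hE x) = f x := by
  choose g hg using hf
  let φ : SDHFree E →ₐ[ℚ] A := FreeAlgebra.lift ℚ
    (Sum.elim (fun a => f (.of hE a)) fun P => ((g P)⁻¹ : Aˣ))
  have h₁ (x : HallAlgebra hE) : φ (hallSymbol E x) = f x := by
    induction x using HallAlgebra.induction with
    | zero => exact (map_zero (φ.toLinearMap ∘ₗ hallSymbol E)).trans (map_zero f).symm
    | add x y hx hy =>
      rw [map_add, ← hx, ← hy]
      exact map_add (φ.toLinearMap ∘ₗ hallSymbol E) x y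
    | smul_of c a =>
      rw [map_smul]
      refine (map_smul (φ.toLinearMap ∘ₗ hallSymbol E) c _).trans (congrArg _ ?_)
      change φ (hallSymbol E (Finsupp.single a 1)) = _
      simp [hallSymbol, φ]
  have h₂ (P : ProjInj E) : φ (FreeAlgebra.ι ℚ (Sum.inr P)) = ((g P)⁻¹ : Aˣ) := by simp [φ]
  have hφ ⦃x y : SDHFree E⦄ (hxy : SDHRel E x y) : φ x = φ y := by
    obtain _ | ⟨x, y⟩ | P | P := hxy
    · exact (h₁ (1 : HallAlgebra hE)).trans ((map_one f).trans (map_one φ).symm)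
    · exact (map_mul φ _ _).trans ((congrArg₂ _ (h₁ x) (h₁ y)).trans
        ((map_mul (M := HallAlgebra hE) f x y).symm.trans (h₁ _).symm))
    · refine (map_mul φ _ _).trans ((congrArg₂ _ (h₁ (.of hE (isoClass P.1))) (h₂ P)).trans ?_)
      rw [← hg, Units.mul_inv, map_one]
    · refine (map_mul φ _ _).trans ((congrArg₂ _ (h₂ P) (h₁ (.of hE (isoClass P.1)))).trans ?_)
      rw [← hg, Units.inv_mul, map_one]
  exact ⟨RingQuot.liftAlgHom ℚ ⟨φ, hφ⟩, fun x =>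
    (RingQuot.liftAlgHom_mkAlgHom_apply ℚ φ hφ (hallSymbol E x)).trans (h₁ x)⟩

variable [IsIdempotentComplete F]

open OreLocalization in
-- The embedding into the Ore localization inverts every `[P]`, hence factors through the
-- semi-derived Hall algebra.
theorem ofHall_injective : Function.Injective (ofHall hE) := by
  let f : HallAlgebra hE →ₐ[ℚ] OreLocalization (HallAlgebra.projSubmonoid hE) (HallAlgebra hE) :=
    { numeratorRingHom with commutes' := fun _ => rfl }
  obtain ⟨ψ, hψ⟩ := exists_algHom hE f fun P =>
    numerator_isUnit (⟨_, HallAlgebra.of_mem_projSubmonoid hE P⟩ : HallAlgebra.projSubmonoid hE)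
  have hf : Function.Injective f :=
    numeratorHom_inj (HallAlgebra.projSubmonoid_le_nonZeroDivisorsLeft hE)
  exact fun x y hxy => hf (by rw [← hψ, hxy, hψ])

end SDH

end SDH

/-! ## Twisted products -/

section Twisted

/-- The group of pairs of an element of `K` and a unit of `A`, with the multiplication twisted by a
biadditive form. -/
@[ext]
structure TwistedUnits {K : Type*} [AddCommGroup K] (_ : K →+ K →+ Additive ℚˣ) (A : Type*)
    [Ring A] where
  /-- The first component. -/
  base : K
  /-- The second component. -/
  unit : Aˣ

variable {K : Type*} [AddCommGroup K] (β : K →+ K →+ Additive ℚˣ) (A : Type*) [Ring A]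
  [Algebra ℚ A]

/-- The scalar units of an algebra. -/
def scalarUnit : ℚˣ →* Aˣ := Units.map (algebraMap ℚ A).toMonoidHom

theorem scalarUnit_mul_comm (c : ℚˣ) (u : Aˣ) : scalarUnit A c * u = u * scalarUnit A c :=
  Units.ext (Algebra.commutes (c : ℚ) (u : A))

theorem mul_scalarUnit_mul (c : ℚˣ) (u w : Aˣ) :
    u * (scalarUnit A c * w) = scalarUnit A c * (u * w) := by
  rw [← mul_assoc, ← scalarUnit_mul_comm, mul_assoc]

theorem val_scalarUnit_mul (c : ℚˣ) (u : Aˣ) :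
    ((scalarUnit A c * u : Aˣ) : A) = (c : ℚ) • (u : A) :=
  (Algebra.smul_def _ _).symm

namespace TwistedUnits

variable {β A}

instance : Mul (TwistedUnits β A) :=
  ⟨fun x y => ⟨x.base + y.base, scalarUnit A (β x.base y.base).toMul * (x.unit * y.unit)⟩⟩

instance : One (TwistedUnits β A) := ⟨⟨0, 1⟩⟩

/-- The factor `β x x` compensates for `β (-x) x = (β x x)⁻¹`. -/
instance : Inv (TwistedUnits β A) :=
  ⟨fun x => ⟨-x.base, scalarUnit A (β x.base x.base).toMul * x.unit⁻¹⟩⟩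

theorem unit_mul (x y : TwistedUnits β A) :
    (x * y).unit = scalarUnit A (β x.base y.base).toMul * (x.unit * y.unit) := rfl

instance : Group (TwistedUnits β A) :=
  Group.ofLeftAxioms
    (fun x y z => by
      refine TwistedUnits.ext (add_assoc _ _ _) ?_
      simp only [unit_mul]
      change scalarUnit A (β (x.base + y.base) z.base).toMul * _ =
        scalarUnit A (β x.base (y.base + z.base)).toMul * _
      rw [mul_scalarUnit_mul A _ x.unit, mul_assoc (scalarUnit A _) (x.unit * y.unit), mul_assoc,
        ← mul_assoc (scalarUnit A _) (scalarUnit A _),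
        ← mul_assoc (scalarUnit A _) (scalarUnit A _),
        ← map_mul (scalarUnit A), ← map_mul (scalarUnit A)]
      congr 2
      simp only [map_add, AddMonoidHom.add_apply, toMul_add]
      ac_rfl)
    (fun x => by
      refine TwistedUnits.ext (zero_add _) ?_
      change scalarUnit A (β 0 x.base).toMul * (1 * x.unit) = x.unit
      simp)
    (fun x => by
      refine TwistedUnits.ext (neg_add_cancel _) ?_
      change scalarUnit A (β (-x.base) x.base).toMul *
        (scalarUnit A (β x.base x.base).toMul * x.unit⁻¹ * x.unit) = 1
      simp)

/-- The projection to the first component. -/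
def baseHom : TwistedUnits β A →* Multiplicative K where
  toFun x := .ofAdd x.base
  map_one' := rfl
  map_mul' _ _ := rfl

end TwistedUnits

end Twisted

/-- The target group need not be commutative, but the subgroup generated by the commuting `g i` is,
and the universal property applies there. -/
theorem exists_freeAbelianGroup_hom {ι G : Type*} [Group G] (g : ι → G)
    (hg : ∀ i j, g i * g j = g j * g i) :
    ∃ f : FreeAbelianGroup ι →+ Additive G, ∀ i, f (.of i) = Additive.ofMul (g i) := by
  let H := Subgroup.closure (Set.range g)
  have : IsMulCommutative H := Subgroup.isMulCommutative_closure (by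
    rintro _ ⟨i, rfl⟩ _ ⟨j, rfl⟩
    exact hg i j)
  let : CommGroup H := { (inferInstance : Group H) with mul_comm := mul_comm' }
  let f : FreeAbelianGroup ι →+ Additive H := FreeAbelianGroup.lift fun i =>
    Additive.ofMul ⟨g i, Subgroup.subset_closure ⟨i, rfl⟩⟩
  refine ⟨(MonoidHom.toAdditive H.subtype).comp f, fun i => ?_⟩
  simp [f]

/-! ## The quantum torus inside the semi-derived Hall algebra -/

section K0

variable {F : Type u} [Category.{v} F] [Preadditive F] {E : ExactStructure F}

theorem K0P.induction {p : K0P E → Prop} (a : K0P E) (zero : p 0)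
    (of : ∀ P, p (K0P.of E P)) (neg_of : ∀ P, p (-K0P.of E P))
    (add : ∀ a b, p a → p b → p (a + b)) : p a := by
  obtain ⟨a, rfl⟩ := QuotientAddGroup.mk'_surjective _ a
  induction a using FreeAbelianGroup.induction_on with
  | zero => exact zero
  | of P => exact of P
  | neg P _ => exact neg_of P
  | add x y hx hy => exact add _ _ hx hy

variable [HasBinaryBiproducts F]

/-- The direct sum of projective-injective objects. -/
def ProjInj.biprod (hE : IsFrobenius E) (P Q : ProjInj E) : ProjInj E :=
  (P.2.1.biprod Q.2.1).toProjInj hE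

theorem ProjInj.isoClass_biprod (hE : IsFrobenius E) (P Q : ProjInj E) :
    isoClass (P.biprod hE Q).1 = isoClass P.1 + isoClass Q.1 := rfl

theorem K0P.of_eq_add {P Q R : ProjInj E} (h : isoClass R.1 = isoClass P.1 + isoClass Q.1) :
    K0P.of E R = K0P.of E P + K0P.of E Q := by
  obtain ⟨φ⟩ := isoClass_eq_iff.1 h
  obtain ⟨w, hc⟩ : IsConf E (biprod.inl ≫ φ.inv : P.1 ⟶ R.1) (φ.hom ≫ biprod.snd : R.1 ⟶ Q.1) :=
    (isConf_biprod P.1 Q.1).of_iso (Iso.refl _) φ.symm (Iso.refl _) (by simp) (by simp)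
  have : (FreeAbelianGroup.of R - FreeAbelianGroup.of P - FreeAbelianGroup.of Q :
      FreeAbelianGroup (ProjInj E)) ∈ K0Relations E :=
    AddSubgroup.subset_closure ⟨P, R, Q, _, _, w, hc, rfl⟩
  rw [← sub_eq_zero, ← sub_sub]
  exact (QuotientAddGroup.eq_zero_iff _).2 this

theorem K0P.of_biprod (hE : IsFrobenius E) (P Q : ProjInj E) :
    K0P.of E (P.biprod hE Q) = K0P.of E P + K0P.of E Q :=
  K0P.of_eq_add (P.isoClass_biprod hE Q)

variable [HasZeroObject F]

/-- The zero object, as a projective-injective object. -/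
def ProjInj.zero (hE : IsFrobenius E) : ProjInj E :=
  (isProjective_of_isZero (isZero_zero F)).toProjInj hE

theorem ProjInj.isoClass_zero (hE : IsFrobenius E) : isoClass (ProjInj.zero hE).1 = 0 := rfl

theorem K0P.of_zero (hE : IsFrobenius E) : K0P.of E (ProjInj.zero hE) = 0 := by
  have h : K0P.of E (ProjInj.zero hE) = K0P.of E (ProjInj.zero hE) + K0P.of E (ProjInj.zero hE) :=
    K0P.of_eq_add (by rw [ProjInj.isoClass_zero, add_zero])
  simpa using h

theorem K0P.of_eq_of (hE : IsFrobenius E) {P Q : ProjInj E}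
    (h : isoClass P.1 = isoClass Q.1) : K0P.of E P = K0P.of E Q := by
  have := K0P.of_eq_add (P := Q) (Q := ProjInj.zero hE) (R := P)
    (by rw [ProjInj.isoClass_zero, add_zero, h])
  rw [this, K0P.of_zero, add_zero]

theorem K0P.exists_of_add_eq_of (hE : IsFrobenius E) (a : K0P E) :
    ∃ R P : ProjInj E, K0P.of E R + a = K0P.of E P := by
  induction a using K0P.induction with
  | zero => exact ⟨ProjInj.zero hE, _, add_zero _⟩
  | of P => exact ⟨ProjInj.zero hE, P, by rw [K0P.of_zero, zero_add]⟩
  | neg_of P => exact ⟨P, ProjInj.zero hE, by rw [K0P.of_zero, add_neg_cancel]⟩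
  | add a b ha hb =>
    obtain ⟨R, P, h⟩ := ha
    obtain ⟨R', P', h'⟩ := hb
    exact ⟨R.biprod hE R', P.biprod hE P', by
      rw [K0P.of_biprod, K0P.of_biprod, ← h, ← h', add_add_add_comm]⟩

/-- A common denominator: one `R` makes all elements of `s` classes of actual objects. It serves to
prove linear independence. -/
theorem K0P.exists_forall_of_add_eq_of (hE : IsFrobenius E) (s : Finset (K0P E)) :
    ∃ R : ProjInj E, ∀ a ∈ s, ∃ P : ProjInj E, K0P.of E R + a = K0P.of E P := by
  classical
  induction s using Finset.induction_on with
  | empty => exact ⟨ProjInj.zero hE, by simp⟩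
  | insert b s _ ih =>
    obtain ⟨R, hR⟩ := ih
    obtain ⟨R', P', h'⟩ := K0P.exists_of_add_eq_of hE b
    refine ⟨R.biprod hE R', fun a ha => ?_⟩
    obtain rfl | ha := Finset.mem_insert.1 ha
    · exact ⟨R.biprod hE P', by rw [K0P.of_biprod, K0P.of_biprod, ← h', add_assoc]⟩
    · obtain ⟨P, hP⟩ := hR a ha
      exact ⟨P.biprod hE R', by rw [K0P.of_biprod, K0P.of_biprod, ← hP, add_right_comm]⟩

end K0

/-! ### The homomorphism from the quantum torus. -/

section TorusHom

variable {F : Type u} [Category.{v} F] [Preadditive F] [HasZeroObject F] [HasBinaryBiproducts F]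
  [∀ A B : F, Finite (A ⟶ B)] {E : ExactStructure F}

open scoped ZeroObject

theorem SDH.cls_mul_cls_left (hE : IsFrobenius E) (P : ProjInj E) (A : F) :
    cls E P.1 * cls E A = (((homCard P.1 A)⁻¹ : ℚˣ) : ℚ) • cls E (P.1 ⊞ A) := by
  rw [← ofHall_of hE, ← ofHall_of hE, ← map_mul, HallAlgebra.of_mul_of_left, map_smul]
  rfl

/-- The twist in `TwistedUnits` by the Euler form cancels the factor `|Hom(P, Q)|⁻¹` of the Hall
product. So `P ↦ ([P], unit [P])` is additive on direct sums, and extends to a group homomorphism on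
`K₀` whose unit component satisfies the torus relations. -/
theorem exists_torusHom (hE : IsFrobenius E) : ∃ φ : QuantumTorus E →ₐ[ℚ] SDH E,
    ∀ P : ProjInj E, φ (QuantumTorus.of E (K0P.of E P)) = SDH.cls E P.1 := by
  let g (P : ProjInj E) : TwistedUnits (euler E) (SDH E) := ⟨K0P.of E P, SDH.unitCls P⟩
  have hg (P Q R : ProjInj E) (h : isoClass R.1 = isoClass P.1 + isoClass Q.1) :
      g P * g Q = g R := by
    refine TwistedUnits.ext (K0P.of_eq_add h).symm (Units.ext ?_)
    have h₁ : (euler E (K0P.of E P) (K0P.of E Q)).toMul = homCard P.1 Q.1 := eulerForm_of E P Q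
    have h₂ : SDH.cls E (P.1 ⊞ Q.1) = SDH.cls E R.1 := by
      rw [SDH.cls, isoClass_biprod, ← h, SDH.cls]
    change ((scalarUnit (SDH E) (euler E (K0P.of E P) (K0P.of E Q)).toMul *
      (SDH.unitCls P * SDH.unitCls Q) : (SDH E)ˣ) : SDH E) = SDH.cls E R.1
    rw [val_scalarUnit_mul, h₁, Units.val_mul]
    change _ • (SDH.cls E P.1 * SDH.cls E Q.1) = _
    rw [SDH.cls_mul_cls_left hE, smul_smul, ← Units.val_mul, mul_inv_cancel, Units.val_one,
      one_smul, h₂]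
  obtain ⟨f, hf⟩ := exists_freeAbelianGroup_hom g fun P Q =>
    (hg P Q (P.biprod hE Q) rfl).trans
      (hg Q P (P.biprod hE Q) (by rw [ProjInj.isoClass_biprod, add_comm])).symm
  -- Conflations of projective-injectives split, so additivity on direct sums is enough to descend
  -- to `K₀`.
  let f' : K0P E →+ Additive (TwistedUnits (euler E) (SDH E)) :=
    QuotientAddGroup.lift (K0Relations E) f (by
      rw [K0Relations, AddSubgroup.closure_le]
      rintro _ ⟨A, B, C, i, p, h, hc, rfl⟩
      obtain ⟨e⟩ := C.2.1.split i p h hc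
      change f _ = 0
      rw [sub_sub, map_sub, map_add, hf, hf, hf, ← ofMul_mul, hg A C B (isoClass_eq_iff.2 ⟨e⟩),
        sub_self])
  have hf' (P : ProjInj E) : f' (K0P.of E P) = Additive.ofMul (g P) := hf P
  -- Since the first component is `a` itself, the scalar in the twisted product is exactly `⟨a, b⟩`.
  have hbase (a : K0P E) : (f' a).toMul.base = a := by
    have : (MonoidHom.toAdditiveLeft TwistedUnits.baseHom).comp f' = AddMonoidHom.id _ := by
      refine QuotientAddGroup.addMonoidHom_ext _ (FreeAbelianGroup.lift_ext _ _ fun P => ?_)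
      change (f' (K0P.of E P)).toMul.base = K0P.of E P
      rw [hf']
      rfl
    exact DFunLike.congr_fun this a
  let σ (a : K0P E) : SDH E := ((f' a).toMul.unit : SDH E)
  have hσ (a b : K0P E) : σ a * σ b = (((eulerForm E a b)⁻¹ : ℚˣ) : ℚ) • σ (a + b) := by
    have h₁ : σ (a + b) = ((eulerForm E a b : ℚˣ) : ℚ) • (σ a * σ b) := by
      change ((f' (a + b)).toMul.unit : SDH E) = _
      rw [map_add, toMul_add, TwistedUnits.unit_mul, val_scalarUnit_mul, hbase, hbase,
        Units.val_mul]
      rfl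
    rw [h₁, smul_smul, Units.inv_mul, one_smul]
  have hσ₀ : σ 0 = 1 := by
    change ((f' 0).toMul.unit : SDH E) = 1
    rw [map_zero]
    rfl
  let L : QuantumTorus E →ₗ[ℚ] SDH E := Finsupp.linearCombination ℚ σ
  have hL (a : K0P E) : L (QuantumTorus.of E a) = σ a :=
    (Finsupp.linearCombination_single ℚ 1 a).trans (one_smul _ _)
  refine ⟨AlgHom.ofLinearMap L ((hL 0).trans hσ₀) fun x y => ?_, fun P => ?_⟩
  · induction x using QuantumTorus.induction with
    | zero => simp
    | add x x' hx hx' => rw [add_mul, map_add, map_add, hx, hx', add_mul]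
    | of c a =>
      induction y using QuantumTorus.induction with
      | zero => simp
      | add x x' hx hx' => rw [mul_add, map_add, map_add, hx, hx', mul_add]
      | of d b =>
        rw [smul_mul_smul_comm, map_smul, map_smul, map_smul, smul_mul_smul_comm, hL, hL, hσ]
        congr 1
        exact (congrArg L (QuantumTorus.mul_of_of E a b)).trans (by rw [map_smul, hL])
  · refine (hL _).trans ?_
    change ((f' (K0P.of E P)).toMul.unit : SDH E) = _
    rw [hf']
    rfl

end TorusHom

end SemiDerived

end

noncomputable section

namespace SemiDerived

/-! ## Elements up to nonzero scalars -/

section ScalarEq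

variable {A : Type*} [Ring A] [Algebra ℚ A]

/-- Two elements agree up to a nonzero rational factor. -/
def ScalarEq (x y : A) : Prop := ∃ c : ℚˣ, x = (c : ℚ) • y

namespace ScalarEq

theorem refl (x : A) : ScalarEq x x := ⟨1, (one_smul ℚ x).symm⟩

theorem symm {x y : A} (h : ScalarEq x y) : ScalarEq y x := by
  obtain ⟨c, rfl⟩ := h
  exact ⟨c⁻¹, by rw [smul_smul, ← Units.val_mul, inv_mul_cancel, Units.val_one, one_smul]⟩

theorem trans {x y z : A} (h : ScalarEq x y) (h' : ScalarEq y z) : ScalarEq x z := by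
  obtain ⟨c, rfl⟩ := h
  obtain ⟨d, rfl⟩ := h'
  exact ⟨c * d, by rw [smul_smul, Units.val_mul]⟩

theorem mul {x y x' y' : A} (h : ScalarEq x y) (h' : ScalarEq x' y') :
    ScalarEq (x * x') (y * y') := by
  obtain ⟨c, rfl⟩ := h
  obtain ⟨d, rfl⟩ := h'
  exact ⟨c * d, by rw [smul_mul_smul_comm, Units.val_mul]⟩

theorem mul_left (z : A) {x y : A} (h : ScalarEq x y) : ScalarEq (z * x) (z * y) := (refl z).mul h

theorem mul_right {x y : A} (h : ScalarEq x y) (z : A) : ScalarEq (x * z) (y * z) := h.mul (refl z)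

theorem mem {x y : A} (h : ScalarEq x y) {N : Submodule ℚ A} (hy : y ∈ N) : x ∈ N := by
  obtain ⟨c, rfl⟩ := h
  exact N.smul_mem _ hy

/-- An element which commutes with `x` up to a scalar commutes with inverses of `x` up to a
scalar. -/
theorem commute_inv {x y z : A} (h : ScalarEq (z * x) (x * z)) (hxy : ScalarEq (x * y) 1)
    (hyx : ScalarEq (y * x) 1) : ScalarEq (z * y) (y * z) := by
  have h₁ : ScalarEq (y * (x * z) * y) (z * y) := by
    simpa [mul_assoc] using hyx.mul_right (z * y)
  have h₂ : ScalarEq (y * (z * x) * y) (y * z) := by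
    simpa [mul_assoc] using hxy.mul_left (y * z)
  exact h₁.symm.trans (((h.symm.mul_left y).mul_right y).trans h₂)

end ScalarEq

end ScalarEq

/-! ## The basis of the semi-derived Hall algebra -/

namespace QuantumTorus

variable {F : Type u} [Category.{v} F] [Preadditive F] [HasBinaryBiproducts F]
  [∀ A B : F, Finite (A ⟶ B)] {E : ExactStructure F}

theorem of_mul_of (a b : K0P E) :
    of E a * of E b = (((eulerForm E a b)⁻¹ : ℚˣ) : ℚ) • of E (a + b) := mul_of_of E a b

theorem of_zero : of E 0 = 1 := rfl

theorem scalarEq_of_add (a b : K0P E) : ScalarEq (of E a * of E b) (of E (a + b)) :=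
  ⟨_, of_mul_of a b⟩

/-- The basis of the quantum torus. -/
def basis : Module.Basis (K0P E) ℚ (QuantumTorus E) := .ofRepr (LinearEquiv.refl ℚ (K0P E →₀ ℚ))

theorem algHom_ext {A : Type*} [Ring A] [Algebra ℚ A] {φ ψ : QuantumTorus E →ₐ[ℚ] A}
    (h : ∀ P, φ (of E (K0P.of E P)) = ψ (of E (K0P.of E P))) : φ = ψ := by
  have key (a : K0P E) : φ (of E a) = ψ (of E a) := by
    induction a using K0P.induction with
    | zero => rw [of_zero, map_one, map_one]
    | of P => exact h P
    -- In the torus, `t_{-[P]}` is a scalar multiple of the inverse of `t_{[P]}`, so its image is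
    -- determined.
    | neg_of P =>
      have h₁ (χ : QuantumTorus E →ₐ[ℚ] A) : χ (of E (K0P.of E P)) * χ (of E (-K0P.of E P)) =
          (((eulerForm E (K0P.of E P) (-K0P.of E P))⁻¹ : ℚˣ) : ℚ) • (1 : A) := by
        rw [← map_mul, of_mul_of, add_neg_cancel, of_zero, map_smul, map_one]
      have h₂ (χ : QuantumTorus E →ₐ[ℚ] A) : χ (of E (-K0P.of E P)) * χ (of E (K0P.of E P)) =
          (((eulerForm E (-K0P.of E P) (K0P.of E P))⁻¹ : ℚˣ) : ℚ) • (1 : A) := by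
        rw [← map_mul, of_mul_of, neg_add_cancel, of_zero, map_smul, map_one]
      have h₃ : IsUnit (ψ (of E (K0P.of E P))) := by
        refine isUnit_iff_exists_and_exists.2
          ⟨⟨((eulerForm E (K0P.of E P) (-K0P.of E P) : ℚˣ) : ℚ) • ψ (of E (-K0P.of E P)), ?_⟩,
            ⟨((eulerForm E (-K0P.of E P) (K0P.of E P) : ℚˣ) : ℚ) • ψ (of E (-K0P.of E P)), ?_⟩⟩
        · rw [mul_smul_comm, h₁, smul_smul, Units.mul_inv, one_smul]
        · rw [smul_mul_assoc, h₂, smul_smul, Units.mul_inv, one_smul]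
      refine h₃.mul_left_cancel ?_
      rw [h₁, ← h, h₁]
    | add a b ha hb =>
      have h₁ (χ : QuantumTorus E →ₐ[ℚ] A) : χ (of E (a + b)) =
          ((eulerForm E a b : ℚˣ) : ℚ) • (χ (of E a) * χ (of E b)) := by
        rw [← map_mul, of_mul_of, map_smul, smul_smul, Units.mul_inv, one_smul]
      rw [h₁, h₁, ha, hb]
  exact AlgHom.toLinearMap_injective (basis.ext key)

end QuantumTorus

section Basis

variable {F : Type u} [Category.{v} F] [Preadditive F] [HasZeroObject F] [HasBinaryBiproducts F]
  [∀ A B : F, Finite (A ⟶ B)] {E : ExactStructure F}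

open QuantumTorus

variable (hE : IsFrobenius E) {φ : QuantumTorus E →ₐ[ℚ] SDH E}

/-- The class in the semi-derived Hall algebra of an isomorphism class. -/
def SDH.isoCls (a : IsoClasses F) : SDH E := ofHall hE (.of hE a)

theorem SDH.isoCls_isoClass (A : F) : SDH.isoCls hE (isoClass A) = SDH.cls E A := rfl

theorem SDH.cls_mul_isoCls (P : ProjInj E) (a : IsoClasses F) :
    ScalarEq (cls E P.1 * isoCls hE a) (isoCls hE (isoClass P.1 + a)) := by
  induction a using Quotient.inductionOn with
  | _ A =>
    refine ⟨(homCard P.1 A)⁻¹, ?_⟩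
    rw [← isoCls_isoClass hE, isoCls, isoCls, isoCls, ← map_smul, ← HallAlgebra.of_mul_of_left,
      map_mul]

theorem SDH.isoCls_mul_cls (P : ProjInj E) (a : IsoClasses F) :
    ScalarEq (isoCls hE a * cls E P.1) (isoCls hE (isoClass P.1 + a)) := by
  induction a using Quotient.inductionOn with
  | _ A =>
    refine ⟨(homCard A P.1)⁻¹, ?_⟩
    rw [← isoCls_isoClass hE, isoCls, isoCls, isoCls, ← map_smul, add_comm (isoClass P.1),
      ← HallAlgebra.of_mul_of_right, map_mul]

theorem scalarEq_map_of_mul (φ : QuantumTorus E →ₐ[ℚ] SDH E) (a b : K0P E) :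
    ScalarEq (φ (of E a) * φ (of E b)) (φ (of E (a + b))) := by
  obtain ⟨c, hc⟩ := scalarEq_of_add a b
  exact ⟨c, by rw [← map_mul, hc, map_smul]⟩

theorem scalarEq_map_of_mul_of_eq {a b c : K0P E} (h : a + b = c)
    (φ : QuantumTorus E →ₐ[ℚ] SDH E) :
    ScalarEq (φ (of E a) * φ (of E b)) (φ (of E c)) := h ▸ scalarEq_map_of_mul φ a b

theorem scalarEq_isoCls_mul_map_of
    (hφ : ∀ P : ProjInj E, φ (of E (K0P.of E P)) = SDH.cls E P.1) (b : IsoClasses F) (a : K0P E) :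
    ScalarEq (SDH.isoCls hE b * φ (of E a)) (φ (of E a) * SDH.isoCls hE b) := by
  have h (P : ProjInj E) : ScalarEq (SDH.isoCls hE b * φ (of E (K0P.of E P)))
      (φ (of E (K0P.of E P)) * SDH.isoCls hE b) := by
    rw [hφ]
    exact (SDH.isoCls_mul_cls hE P b).trans (SDH.cls_mul_isoCls hE P b).symm
  induction a using K0P.induction with
  | zero => rw [of_zero, map_one, mul_one, one_mul]; exact .refl _
  | of P => exact h P
  | neg_of P =>
    have h₀ : φ (of E 0) = 1 := map_one φ
    refine (h P).commute_inv ?_ ?_ <;> rw [← h₀]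
    · exact scalarEq_map_of_mul_of_eq (add_neg_cancel _) φ
    · exact scalarEq_map_of_mul_of_eq (neg_add_cancel _) φ
  | add a b ha hb =>
    have h₁ := scalarEq_map_of_mul φ a b
    refine (h₁.symm.mul_left _).trans (.trans ?_ (h₁.mul_right _))
    rw [← mul_assoc, mul_assoc _ _ (SDH.isoCls hE _)]
    refine (ha.mul_right _).trans ?_
    rw [mul_assoc]
    exact hb.mul_left _

theorem scalarEq_invCls (hφ : ∀ P : ProjInj E, φ (of E (K0P.of E P)) = SDH.cls E P.1)
    (P : ProjInj E) : ScalarEq (SDH.invCls P) (φ (of E (-K0P.of E P))) := by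
  have h₀ : φ (of E 0) = 1 := map_one φ
  have h := (scalarEq_map_of_mul_of_eq (add_neg_cancel (K0P.of E P)) φ).symm.mul_left
    (SDH.invCls P)
  rwa [h₀, mul_one, hφ, ← mul_assoc, SDH.invCls_mul_cls, one_mul] at h

variable [IsIdempotentComplete F] {rep : IsoClasses (Stable E) → F}

/-- Translates of the classes of representatives of the stable isomorphism classes. -/
def translates (φ : QuantumTorus E →ₐ[ℚ] SDH E) (rep : IsoClasses (Stable E) → F)
    (i : K0P E × IsoClasses (Stable E)) : SDH E :=
  φ (of E i.1) * SDH.cls E (rep i.2)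

/-- An isomorphism `A ⊕ P ≅ M_α ⊕ Q` gives `[P] [A] ~ [Q] [M_α]` up to scalars, so `[A]` is a
multiple of the translate of `[M_α]` by `[Q] - [P]`. -/
theorem exists_scalarEq_translates
    (hφ : ∀ P : ProjInj E, φ (of E (K0P.of E P)) = SDH.cls E P.1)
    (hrep : ∀ α, stableClass E (rep α) = α) (a : K0P E) (b : IsoClasses F) :
    ∃ i, ScalarEq (φ (of E a) * SDH.isoCls hE b) (translates φ rep i) := by
  induction b using Quotient.inductionOn with
  | _ A =>
    obtain ⟨P, Q, h⟩ := (stableClass_eq_iff hE).1 (hrep (stableClass E A)).symm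
    refine ⟨(a + -K0P.of E P + K0P.of E Q, stableClass E A), ?_⟩
    have h₁ := (scalarEq_map_of_mul_of_eq (neg_add_cancel_right a (K0P.of E P)) φ).symm.mul_right
      (SDH.isoCls hE (isoClass A))
    have h₂ := (scalarEq_map_of_mul φ (a + -K0P.of E P) (K0P.of E Q)).mul_right
      (SDH.isoCls hE (isoClass (rep (stableClass E A))))
    have h₃ := SDH.cls_mul_isoCls hE P (isoClass A)
    have h₄ := SDH.cls_mul_isoCls hE Q (isoClass (rep (stableClass E A)))
    rw [mul_assoc, hφ] at h₁ h₂
    rw [add_comm, h, add_comm] at h₃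
    exact h₁.trans (((h₃.trans h₄.symm).mul_left _).trans h₂)

theorem span_translates (hE : IsFrobenius E)
    (hφ : ∀ P : ProjInj E, φ (of E (K0P.of E P)) = SDH.cls E P.1)
    (hrep : ∀ α, stableClass E (rep α) = α) :
    Submodule.span ℚ (Set.range (translates φ rep)) = ⊤ := by
  set N := Submodule.span ℚ (Set.range (translates φ rep))
  have h₁ (a : K0P E) (x : HallAlgebra hE) : φ (of E a) * SDH.ofHall hE x ∈ N := by
    induction x using HallAlgebra.induction with
    | zero => simp
    | add x y hx hy => rw [map_add, mul_add]; exact N.add_mem hx hy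
    | smul_of c b =>
      rw [map_smul, mul_smul_comm]
      obtain ⟨i, hi⟩ := exists_scalarEq_translates hE hφ hrep a b
      exact N.smul_mem _ (hi.mem (Submodule.subset_span ⟨i, rfl⟩))
  -- The span is a left ideal; as it contains `1`, it is everything.
  have h₂ (s : SDH E) : ∀ y ∈ N, s * y ∈ N := by
    have key (s : SDH E) (hs : ∀ i, s * translates φ rep i ∈ N) (y : SDH E) (hy : y ∈ N) :
        s * y ∈ N := by
      induction hy using Submodule.span_induction with
      | mem y hy => obtain ⟨i, rfl⟩ := hy; exact hs i
      | zero => simp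
      | add y z _ _ hy hz => rw [mul_add]; exact N.add_mem hy hz
      | smul c y _ hy => rw [mul_smul_comm]; exact N.smul_mem _ hy
    induction s using SDH.induction with
    | algebraMap c => intro y hy; rw [← Algebra.smul_def]; exact N.smul_mem _ hy
    | add s t hs ht => intro y hy; rw [add_mul]; exact N.add_mem (hs y hy) (ht y hy)
    | mul s t hs ht => intro y hy; rw [mul_assoc]; exact hs _ (ht y hy)
    | cls A =>
      refine key _ fun ⟨a, α⟩ => ?_
      rw [translates, ← mul_assoc]
      refine ((scalarEq_isoCls_mul_map_of hE hφ (isoClass A) a).mul_right _).mem ?_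
      rw [mul_assoc, ← SDH.isoCls_isoClass hE, SDH.isoCls, SDH.isoCls, ← map_mul]
      exact h₁ a _
    | invCls P =>
      refine key _ fun ⟨a, α⟩ => ?_
      rw [translates, ← mul_assoc]
      refine ((((scalarEq_invCls hφ P).mul_right _).trans (scalarEq_map_of_mul φ _ _)).mul_right
        _).mem ?_
      exact Submodule.subset_span ⟨(_, α), rfl⟩
  refine eq_top_iff.2 fun s _ => ?_
  have := h₁ 0 1
  rw [of_zero, map_one, map_one, mul_one] at this
  simpa using h₂ s 1 this

theorem linearIndependent_isoCls : LinearIndependent ℚ (SDH.isoCls hE) :=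
  (HallAlgebra.linearIndependent_of hE).map' (SDH.ofHall hE).toLinearMap
    (LinearMap.ker_eq_bot.2 (SDH.ofHall_injective hE))

theorem linearIndependent_translates (hE : IsFrobenius E)
    (hφ : ∀ P : ProjInj E, φ (of E (K0P.of E P)) = SDH.cls E P.1)
    (hrep : ∀ α, stableClass E (rep α) = α) :
    LinearIndependent ℚ (translates φ rep) := by
  classical
  rw [linearIndependent_iff_finset_linearIndependent]
  intro s
  -- Multiplication by `[R]` moves the finite subfamily into the image of the Hall algebra, up to
  -- nonzero scalars.
  obtain ⟨R, hR⟩ := K0P.exists_forall_of_add_eq_of hE (s.image Prod.fst)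
  have hR' (i : s) : ∃ P : ProjInj E, K0P.of E R + i.1.1 = K0P.of E P :=
    hR _ (Finset.mem_image_of_mem _ i.2)
  choose P hP using hR'
  let j (i : s) : IsoClasses F := isoClass (P i).1 + isoClass (rep i.1.2)
  -- The stable class of `P i ⊕ M_α` recovers `α`. Cancelling `M_α` then recovers `P i`, and with it
  -- the element of `K₀`.
  have hj : Function.Injective j := by
    rintro ⟨⟨a, α⟩, hi⟩ ⟨⟨b, β⟩, hi'⟩ h
    have hαβ : α = β := by
      rw [← hrep α, ← hrep β, stableClass_eq_iff hE]
      exact ⟨P ⟨(a, α), hi⟩, P ⟨(b, β), hi'⟩, by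
        rw [add_comm, add_comm (isoClass (rep β))]
        exact h⟩
    subst hαβ
    have h' := K0P.of_eq_of hE (add_right_cancel h)
    rw [← hP, ← hP] at h'
    exact Subtype.ext (Prod.ext (add_left_cancel h') rfl)
  have hs (i : s) : ScalarEq (SDH.cls E R.1 * translates φ rep i.1) (SDH.isoCls hE (j i)) := by
    have h₁ := (scalarEq_map_of_mul_of_eq (hP i) φ).mul_right (SDH.cls E (rep i.1.2))
    rw [hφ, hφ, mul_assoc] at h₁
    exact h₁.trans (SDH.cls_mul_isoCls hE (P i) (isoClass (rep i.1.2)))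
  choose c hc using hs
  have := ((linearIndependent_isoCls hE).comp j hj).units_smul c
  refine LinearIndependent.of_comp (LinearMap.mulLeft ℚ (SDH.cls E R.1)) ?_
  have h : ⇑(LinearMap.mulLeft ℚ (SDH.cls E R.1)) ∘ translates φ rep ∘ Subtype.val =
      c • (SDH.isoCls hE ∘ j) := funext hc
  exact h ▸ this

/-- The basis of the semi-derived Hall algebra consisting of the translates of the classes of
representatives of the stable isomorphism classes. -/
def translatesBasis (hE : IsFrobenius E)
    (hφ : ∀ P : ProjInj E, φ (of E (K0P.of E P)) = SDH.cls E P.1)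
    (hrep : ∀ α, stableClass E (rep α) = α) :
    Module.Basis (K0P E × IsoClasses (Stable E)) ℚ (SDH E) :=
  .mk (linearIndependent_translates hE hφ hrep) (span_translates hE hφ hrep).ge

theorem translatesBasis_apply (hE : IsFrobenius E)
    (hφ : ∀ P : ProjInj E, φ (of E (K0P.of E P)) = SDH.cls E P.1)
    (hrep : ∀ α, stableClass E (rep α) = α) (i : K0P E × IsoClasses (Stable E)) :
    translatesBasis hE hφ hrep i = φ (of E i.1) * SDH.cls E (rep i.2) :=
  Module.Basis.mk_apply _ _ _

theorem exists_basis_mul_right (hE : IsFrobenius E)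
    (hφ : ∀ P : ProjInj E, φ (of E (K0P.of E P)) = SDH.cls E P.1)
    (hrep : ∀ α, stableClass E (rep α) = α) :
    ∃ b : Module.Basis (K0P E × IsoClasses (Stable E)) ℚ (SDH E),
      ∀ i, b i = SDH.cls E (rep i.2) * φ (of E i.1) := by
  have h (i : K0P E × IsoClasses (Stable E)) :=
    scalarEq_isoCls_mul_map_of hE hφ (isoClass (rep i.2)) i.1
  choose c hc using h
  refine ⟨(translatesBasis hE hφ hrep).unitsSMul c, fun i => ?_⟩
  rw [Module.Basis.unitsSMul_apply, translatesBasis_apply]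
  exact (hc i).symm

end Basis

/-! ### From rational bases to bases over the torus. -/

/-- If the products of a basis of `T` with a family of elements form a basis of a `T`-module `S`
over the ground ring, then the family is a basis over `T`. -/
theorem exists_basis_of_basis_smul {R T S κ ι : Type*} [CommRing R] [Ring T] [Algebra R T]
    [AddCommGroup S] [Module R S] [Module T S] [IsScalarTower R T S] (t : Module.Basis κ R T)
    (m : ι → S) (b : Module.Basis (κ × ι) R S) (hb : ∀ i, b i = t i.1 • m i.2) :
    ∃ B : Module.Basis ι T S, ∀ i, B i = m i := by
  let L : (ι →₀ T) →ₗ[T] S := Finsupp.linearCombination T m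
  let e : (ι →₀ T) ≃ₗ[R] S := (Finsupp.basis fun _ : ι => t).equiv b
    ((Equiv.sigmaEquivProd ι κ).trans (Equiv.prodComm ι κ))
  have he : L.restrictScalars R = e.toLinearMap := by
    refine (Finsupp.basis fun _ : ι => t).ext fun ⟨i, k⟩ => ?_
    have h₁ : e (Finsupp.basis (fun _ : ι => t) ⟨i, k⟩) = b (k, i) := Module.Basis.equiv_apply ..
    refine Eq.trans ?_ (h₁.trans (hb _)).symm
    simp [L]
  have hL : Function.Bijective L := by
    have : ⇑L = e := congrArg DFunLike.coe he
    rw [this]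
    exact e.bijective
  refine ⟨.ofRepr (LinearEquiv.ofBijective L hL).symm, fun i => ?_⟩
  simp [L]

theorem exists_stableClass_eq {F : Type u} [Category.{v} F] [Preadditive F] (E : ExactStructure F)
    (α : IsoClasses (Stable E)) : ∃ M : F, stableClass E M = α := by
  obtain ⟨⟨M⟩⟩ := α
  exact ⟨M, rfl⟩

end SemiDerived

end

theorem theorem3 {k : Type*} [Field k] {F : Type u} [Category.{v} F] [Preadditive F]
    [HasZeroObject F] [HasBinaryBiproducts F] [Linear k F] [EssentiallySmall.{w} F]
    [IsIdempotentComplete F] [∀ A B : F, Finite (A ⟶ B)]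
    (E : ExactStructure F) (hE : IsFrobenius E) :
    (∃! φ : QuantumTorus E →ₐ[ℚ] SDH E,
      ∀ P : ProjInj E, φ (QuantumTorus.of E (K0P.of E P)) = SDH.cls E P.1) ∧
    ∀ φ : QuantumTorus E →ₐ[ℚ] SDH E,
      (∀ P : ProjInj E, φ (QuantumTorus.of E (K0P.of E P)) = SDH.cls E P.1) →
      letI : Module (QuantumTorus E) (SDH E) := leftAction φ
      letI : Module (QuantumTorus E)ᵐᵒᵖ (SDH E) := rightAction φ
      Module.Free (QuantumTorus E) (SDH E) ∧
      Module.Free (QuantumTorus E)ᵐᵒᵖ (SDH E) ∧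
      ∀ rep : IsoClasses (Stable E) → F, (∀ α, stableClass E (rep α) = α) →
        (∃ b : Module.Basis (IsoClasses (Stable E)) (QuantumTorus E) (SDH E),
          ∀ α, b α = SDH.cls E (rep α)) ∧
        (∃ b : Module.Basis (IsoClasses (Stable E)) (QuantumTorus E)ᵐᵒᵖ (SDH E),
          ∀ α, b α = SDH.cls E (rep α)) := by
  refine ⟨?_, fun φ hφ => ?_⟩
  · obtain ⟨φ, hφ⟩ := exists_torusHom hE
    exact ⟨φ, hφ, fun ψ hψ => QuantumTorus.algHom_ext fun P => (hψ P).trans (hφ P).symm⟩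
  let : Module (QuantumTorus E) (SDH E) := leftAction φ
  let : Module (QuantumTorus E)ᵐᵒᵖ (SDH E) := rightAction φ
  have towerL : IsScalarTower ℚ (QuantumTorus E) (SDH E) := ⟨fun q t s => by
    change φ (q • t) * s = q • (φ t * s)
    rw [map_smul, smul_mul_assoc]⟩
  have towerR : IsScalarTower ℚ (QuantumTorus E)ᵐᵒᵖ (SDH E) := ⟨fun q t s => by
    change s * φ (q • t.unop) = q • (s * φ t.unop)
    rw [map_smul, mul_smul_comm]⟩
  have key (rep : IsoClasses (Stable E) → F) (hrep : ∀ α, stableClass E (rep α) = α) :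
      (∃ b : Module.Basis (IsoClasses (Stable E)) (QuantumTorus E) (SDH E),
        ∀ α, b α = SDH.cls E (rep α)) ∧
      (∃ b : Module.Basis (IsoClasses (Stable E)) (QuantumTorus E)ᵐᵒᵖ (SDH E),
        ∀ α, b α = SDH.cls E (rep α)) := by
    refine ⟨exists_basis_of_basis_smul QuantumTorus.basis (fun α => SDH.cls E (rep α))
      (translatesBasis hE hφ hrep) (translatesBasis_apply hE hφ hrep), ?_⟩
    obtain ⟨b, hb⟩ := exists_basis_mul_right hE hφ hrep
    let op : QuantumTorus E ≃ₗ[ℚ] (QuantumTorus E)ᵐᵒᵖ := MulOpposite.opLinearEquiv ℚ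
    exact exists_basis_of_basis_smul (QuantumTorus.basis.map op) (fun α => SDH.cls E (rep α)) b
      fun i => (hb i).trans (by rw [Module.Basis.map_apply]; rfl)
  choose rep hrep using exists_stableClass_eq E
  obtain ⟨⟨b, -⟩, ⟨b', -⟩⟩ := key rep hrep
  exact ⟨.of_basis b, .of_basis b', key⟩
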